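/- Let $n\ge 1$, $\alpha>0$, $T>0$, $L\in(0,1)$ and $\Omega=(0,\pi)^n$. For a multi-index $j=(j_1,\dots,j_n)$ of positive integers put $$\phi_j(x)=\Big(\frac2\pi\Big)^{n/2}\prod_{k=1}^n\sin(j_kx_k),\qquad \lambda_j=\Big(\sum_{k=1}^n j_k^2\Big)^{\alpha},\qquad \gamma_j(T)=\frac{e^{2\lambda_jT}-1}{2\lambda_j},$$ so that $(\phi_j)$ is the usual Hilbert basis of $L^2(\Omega)$ of eigenfunctions of $A_0=(-\Delta)^\alpha$ ($\Delta$ the Dirichlet-Laplacian, the power being defined spectrally) and $(\lambda_j)$ are the eigenvalues. Write $\mathbf 1=(1,\dots,1)$. Let $\mathcal U_L$ be the set of measurable $\omega\subset\Omega$ with $|\omega|=L|\Omega|$, and let $$J(\omega)=\inf_{j}\gamma_j(T)\int_\omega\phi_j(x)^2\,dx .$$ Let $F(s)=\frac1\pi(s-\sin s)$ on $[0,\pi]$, let $f(u)=F(\pi u)=u-\frac1\pi\sin(\pi u)$ on $[0,1]$, and let $f^{[n]}$ be the $n$-fold composition of $f$ with itself (for $n=1$, $f^{[1]}(s/\pi)=F(s)$).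 1. (Uniform lower bound.) For every measurable $\rho:\Omega\to[0,1]$ and every multi-index $j$, $$\int_\Omega\rho\,\phi_j^2\,dx\ \ge\ f^{[n]}\Big(\pi^{-n}\int_\Omega\rho\,dx\Big),$$ and the right-hand side is positive if $\int_\Omega\rho>0$. 2. (Assumption $(H_2)$.) For every $a\in L^\infty(\Omega;[0,1])$ with $\int_\Omega a\,dx=L|\Omega|$, $$\liminf_{|j|\to\infty}\gamma_j(T)\int_\Omega a\,\phi_j^2\,dx>\gamma_{\mathbf 1}(T).$$ 3. (Optimal set.) There is an open semi-analytic set $\omega^*\in\mathcal U_L$ that maximizes $J$ over $\mathcal U_L$, and every maximizer of $J$ over $\mathcal U_L$ equals $\omega^*$ up to a set of measure zero. 4. (Explicit number of modes.) The multi-indices can be listed as a sequence $\sigma(1),\sigma(2),\dots$ (each exactly once) with $\lambda_{\sigma(1)}\le\lambda_{\sigma(2)}\le\cdots$. For any such enumeration there is a least integer $N_0\ge1$ with $$\gamma_{\sigma(N_0)}(T)\ \ge\ \frac{\gamma_{\mathbf 1}(T)}{f^{[n]}(L)},$$ and for every $N\ge N_0$ the set $\omega^*$ is also the unique (up to null sets)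 maximizer over $\mathcal U_L$ of the truncated functional $J_N(\omega)=\min_{1\le i\le N}\gamma_{\sigma(i)}(T)\int_\omega\phi_{\sigma(i)}^2\,dx$, and $J_N(\omega^*)=J(\omega^*)$. -/

import Mathlib

open MeasureTheory Filter Topology

noncomputable section

/-- The open orthotope `(0, π)^n`. -/
def orthotope (n : ℕ) : Set (Fin n → ℝ) :=
  Set.univ.pi fun _ => Set.Ioo 0 Real.pi

/-- The eigenfunction `(2/π)^{n/2} ∏ₖ sin (jₖ xₖ)` of the Dirichlet-Laplacian on `(0, π)^n`,
for a multi-index `j` of positive integers. -/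
def sineMode {n : ℕ} (j : Fin n → ℕ+) (x : Fin n → ℝ) : ℝ :=
  (2 / Real.pi) ^ ((n : ℝ) / 2) * ∏ k, Real.sin ((j k : ℝ) * x k)

/-- The eigenvalue of `(-Δ)^α` (spectral fractional power of the Dirichlet-Laplacian) on
`sineMode j`: the `α`-th power of the Laplace eigenvalue `∑ₖ jₖ²`. -/
def modeEigenvalue {n : ℕ} (α : ℝ) (j : Fin n → ℕ+) : ℝ :=
  (∑ k, (j k : ℝ) ^ 2) ^ α

/-- The weight attached to a real eigenvalue `lam` and an observation time `T`,
that is, `∫₀ᵀ exp (2 lam t) dt`. -/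
def timeWeight (lam T : ℝ) : ℝ :=
  if lam = 0 then T else (Real.exp (2 * lam * T) - 1) / (2 * lam)

/-- The weight `γ_j(T)` of the mode `j`. -/
def modeWeight {n : ℕ} (α T : ℝ) (j : Fin n → ℕ+) : ℝ :=
  timeWeight (modeEigenvalue α j) T

/-- Lebesgue measurable subsets `ω` of the orthotope with `|ω| = L |Ω|`. -/
def admissibleSets (n : ℕ) (L : ℝ) : Set (Set (Fin n → ℝ)) :=
  {ω | ω ⊆ orthotope n ∧ NullMeasurableSet ω volume ∧
    volume ω = ENNReal.ofReal L * volume (orthotope n)}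

/-- `ρ` represents an element of `L^∞(Ω; [0,1])`. -/
def IsDensity (n : ℕ) (ρ : (Fin n → ℝ) → ℝ) : Prop :=
  AEStronglyMeasurable ρ (volume.restrict (orthotope n)) ∧
    ∀ᵐ x ∂volume.restrict (orthotope n), ρ x ∈ Set.Icc (0 : ℝ) 1

/-- The functional `J(χ_ω) = inf_j γ_j(T) ∫_ω φ_j²`. -/
def obsFunctional {n : ℕ} (α T : ℝ) (ω : Set (Fin n → ℝ)) : ℝ :=
  ⨅ j : Fin n → ℕ+, modeWeight α T j * ∫ x in ω, sineMode j x ^ 2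

/-- `σ` lists all modes, by nondecreasing eigenvalue. -/
def IsOrderedEnumeration {n : ℕ} (α : ℝ) (σ : ℕ+ ≃ (Fin n → ℕ+)) : Prop :=
  Monotone fun i => modeEigenvalue α (σ i)

/-- The truncated functional `J_N(χ_ω)`: the infimum runs over the first `N` modes only. -/
def truncFunctional {n : ℕ} (α T : ℝ) (σ : ℕ+ ≃ (Fin n → ℕ+)) (N : ℕ+)
    (ω : Set (Fin n → ℝ)) : ℝ :=
  ⨅ i : Set.Iic N, modeWeight α T (σ i) * ∫ x in ω, sineMode (σ i) x ^ 2

/-- The spectral assumption `(H₂)`. The inferior limit is taken in the extended reals, and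
along the cofinite filter of the modes, which is the limit `i → ∞` for any enumeration. -/
def SpectralH2 (n : ℕ) (α T L : ℝ) : Prop :=
  ∀ a : (Fin n → ℝ) → ℝ, IsDensity n a →
    ∫ x in orthotope n, a x = L * volume.real (orthotope n) →
    ((modeWeight α T (fun _ : Fin n => (1 : ℕ+)) : ℝ) : EReal) <
      liminf (fun j : Fin n → ℕ+ =>
        ((modeWeight α T j * ∫ x in orthotope n, a x * sineMode j x ^ 2 : ℝ) : EReal)) cofinite

/-- The function `F(s) = (s - sin s)/π`. -/
def sineGap (s : ℝ) : ℝ := (s - Real.sin s) / Real.pi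

/-- The lower bound `f^{[n]}(s / π^n)`, the `n`-fold composition of
`f(u) = F(π u) = u - sin(π u)/π`. For `n = 1` this is `F(s)`. -/
def sineLowerBound (n : ℕ) (s : ℝ) : ℝ :=
  (fun u => sineGap (Real.pi * u))^[n] (s / Real.pi ^ n)

/-- Semi-analytic subsets of a real normed space: near every point of the space the set is a
finite union of sets given by finitely many equations and strict inequalities between real
analytic functions. -/
def IsSemiAnalytic {E : Type*} [NormedAddCommGroup E] [NormedSpace ℝ E] (S : Set E) : Prop :=
  ∀ x : E, ∃ U : Set E, IsOpen U ∧ x ∈ U ∧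
    ∃ (p q r : ℕ) (f : Fin p → Fin q → E → ℝ) (g : Fin p → Fin r → E → ℝ),
      (∀ i k, AnalyticOnNhd ℝ (f i k) U) ∧ (∀ i k, AnalyticOnNhd ℝ (g i k) U) ∧
      S ∩ U = {y | y ∈ U ∧ ∃ i, (∀ k, f i k y = 0) ∧ ∀ k, 0 < g i k y}

/-- `ω` maximizes `Φ` over the admissible sets, and every other maximizer differs from `ω` by
a null set only. -/
def IsUniqueOptimalSet (n : ℕ) (L : ℝ) (Φ : Set (Fin n → ℝ) → ℝ) (ω : Set (Fin n → ℝ)) : Prop :=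
  ω ∈ admissibleSets n L ∧ (∀ ω' ∈ admissibleSets n L, Φ ω' ≤ Φ ω) ∧
    ∀ ω' ∈ admissibleSets n L, Φ ω' = Φ ω → ω' =ᵐ[volume] ω

end

/-! The lower bound starts in dimension one. Write `2 sin² = 1 - cos (2 j x)` and let `s` be the
mass of `ρ`; integrating `ρ (cos (2 j x) - cos s) ≤ (cos (2 j x) - cos s)⁺` gives exactly `F(s)`.
Since `(0, π)` carries `j` full periods, the right side does not depend on `j`
(`sineGap_integral_le`). In higher dimension, slice along the first coordinate, apply the bound to
each slice, use Jensen for the convex function `f^{[n]}`, and apply the one-dimensional bound to the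
resulting density (`iterate_sineStep_le_integral`).

The weights tend to infinity, so this bound yields `(H₂)`. It also makes all but finitely many modes
irrelevant: the first mode contributes at most `γ_𝟏`, while mode `j` contributes at least `γ_j
f^{[n]}(L)`. Hence `J` is a minimum over finitely many modes on every admissible set
(`iInf_modes_eq_obsFunctional`).

The finite problem is solved by duality (`exists_superlevel_unique_maximin`). For a convex
combination `ψ_b` of the weighted squared modes, the bathtub principle gives a superlevel set as
maximizer of `∫_ω ψ_b`, unique because analyticity makes level sets null. The value `D b` attains
its minimum on the simplex, and stability of the bathtub maximizer shows that the superlevel set at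
a minimizing `b` solves the maximin problem. Being cut out of the box by an analytic inequality, it
is open and semi-analytic. -/

/-- The zero set of a real analytic function on `ℝⁿ` which is not identically zero is null. -/
theorem volume_zeroSet_eq_zero_of_analyticOnNhd {n : ℕ} {f : (Fin n → ℝ) → ℝ}
    (hf : AnalyticOnNhd ℝ f Set.univ) {x : Fin n → ℝ} (hx : f x ≠ 0) :
    volume {y | f y = 0} = 0 := by
  induction n with
  | zero =>
    have : {y | f y = 0} = ∅ := by
      ext y
      simpa [Subsingleton.elim y x] using hx
    simp [this]
  | succ n ih =>
    have hcons : ∀ s : ℝ, AnalyticOnNhd ℝ (fun y : Fin n → ℝ => (Fin.cons s y : Fin (n + 1) → ℝ))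
        Set.univ := by
      intro s y _
      rw [analyticAt_pi_iff]
      intro k
      refine Fin.cases ?_ (fun k => ?_) k
      · simpa using analyticAt_const
      · exact (ContinuousLinearMap.proj (R := ℝ) (φ := fun _ : Fin n => ℝ) k).analyticAt y
    have hcons' : AnalyticOnNhd ℝ (fun s : ℝ => (Fin.cons s (Fin.tail x) : Fin (n + 1) → ℝ))
        Set.univ := by
      intro y _
      rw [analyticAt_pi_iff]
      intro k
      refine Fin.cases ?_ (fun k => ?_) k
      · exact analyticAt_id
      · simpa using analyticAt_const
    have hmeas : MeasurableSet {p : ℝ × (Fin n → ℝ) | f (Fin.cons p.1 p.2) = 0} := by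
      have hc : Continuous f := continuousOn_univ.1 hf.continuousOn
      have : Continuous fun p : ℝ × (Fin n → ℝ) => f (Fin.cons p.1 p.2) := by fun_prop
      exact (isClosed_eq this continuous_const).measurableSet
    have hpre : {y | f y = 0} = MeasurableEquiv.piFinSuccAbove (fun _ => ℝ) 0 ⁻¹'
        {p : ℝ × (Fin n → ℝ) | f (Fin.cons p.1 p.2) = 0} := by
      ext y
      simp [MeasurableEquiv.piFinSuccAbove, Fin.insertNthEquiv]
    rw [hpre, (volume_preserving_piFinSuccAbove (fun _ => ℝ) 0).measure_preimage
      hmeas.nullMeasurableSet, Measure.volume_eq_prod, Measure.measure_prod_null hmeas]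
    -- The line through `x` in the first direction meets the zero set in a discrete, hence null,
    -- set. For every other `s` the slice is nonzero at `Fin.tail x`, so the induction hypothesis
    -- makes its zero set null, and Fubini concludes.
    have h1 : AnalyticOnNhd ℝ (fun s : ℝ => f (Fin.cons s (Fin.tail x))) Set.univ :=
      hf.comp hcons' (Set.mapsTo_univ _ _)
    have h2 := h1.preimage_zero_mem_codiscrete (x := x 0) (by simpa using hx)
    have h3 := ae_restrict_le_codiscreteWithin (μ := (volume : Measure ℝ)) MeasurableSet.univ h2
    rw [Measure.restrict_univ] at h3
    filter_upwards [h3] with s hs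
    exact ih (hf.comp (hcons s) (Set.mapsTo_univ _ _)) (x := Fin.tail x) (by simpa using hs)

/-! ### Bathtub principle and finite maximin problems -/

section Bathtub

variable {X : Type*} [MeasurableSpace X] {μ : Measure X} [IsFiniteMeasure μ]

/-- A bounded function without level sets of positive measure has superlevel sets of every
prescribed measure. -/
theorem exists_measureReal_superlevel_eq {ψ : X → ℝ} (hψ : Measurable ψ) {C : ℝ}
    (hC : ∀ x, |ψ x| ≤ C) (hlev : ∀ ξ, μ {x | ψ x = ξ} = 0) {m : ℝ}
    (hm : m ∈ Set.Icc 0 (μ.real Set.univ)) : ∃ ξ, μ.real {x | ξ < ψ x} = m := by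
  have hms : ∀ ξ, MeasurableSet {x | ξ < ψ x} := fun ξ => measurableSet_lt measurable_const hψ
  have hint : ∀ ξ, μ.real {x | ξ < ψ x} = ∫ x, {y | ξ < ψ y}.indicator (fun _ => (1 : ℝ)) x ∂μ := by
    intro ξ
    rw [integral_indicator (hms ξ)]
    simp
  -- Dominated convergence: for fixed `x` the indicator jumps only at the threshold `ψ x`, and `ψ x
  -- = ξ` happens on a null set.
  have hcont : Continuous fun ξ => μ.real {x | ξ < ψ x} := by
    rw [continuous_iff_continuousAt]
    intro ξ
    simp_rw [hint]
    refine continuousAt_of_dominated (bound := fun _ => 1) ?_ ?_ (integrable_const _) ?_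
    · exact Eventually.of_forall fun η =>
        ((measurable_const.indicator (hms η))).aestronglyMeasurable
    · refine Eventually.of_forall fun η => ae_of_all _ fun x => ?_
      refine (norm_indicator_le_norm_self _ _).trans (by simp)
    · have : ∀ᵐ x ∂μ, ψ x ≠ ξ := by
        rw [ae_iff]
        simpa using hlev ξ
      filter_upwards [this] with x hx
      rcases lt_or_gt_of_ne hx with h | h
      · refine (continuousAt_const (y := (0 : ℝ))).congr ?_
        filter_upwards [lt_mem_nhds h] with η hη
        simp [Set.indicator, not_lt.2 hη.le]
      · refine (continuousAt_const (y := (1 : ℝ))).congr ?_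
        filter_upwards [gt_mem_nhds h] with η hη
        simp [Set.indicator, hη]
  have h0 : μ.real {x | C < ψ x} = 0 := by
    have : {x | C < ψ x} = ∅ := by
      ext x
      simpa using (abs_le.1 (hC x)).2
    simp [this]
  have h1 : μ.real {x | -C - 1 < ψ x} = μ.real Set.univ := by
    congr 1
    ext x
    have := (abs_le.1 (hC x)).1
    simp
    linarith
  have := mem_range_of_exists_le_of_exists_ge hcont ⟨C, h0.le.trans hm.1⟩
    ⟨-C - 1, hm.2.trans h1.ge⟩
  exact this

/-- The defect of optimality in the bathtub principle. -/
theorem setIntegral_superlevel_sub_setIntegral {ψ : X → ℝ} (hψ : Measurable ψ)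
    (hi : Integrable ψ μ) {ξ : ℝ} {ω : Set X} (hω : NullMeasurableSet ω μ)
    (hm : μ.real ω = μ.real {x | ξ < ψ x}) :
    ∫ x in {x | ξ < ψ x}, ψ x ∂μ - ∫ x in ω, ψ x ∂μ =
      ∫ x in symmDiff {x | ξ < ψ x} ω, |ψ x - ξ| ∂μ := by
  have hs : NullMeasurableSet {x | ξ < ψ x} μ :=
    (measurableSet_lt measurable_const hψ).nullMeasurableSet
  have hξ : Integrable (fun x => ψ x - ξ) μ := hi.sub (integrable_const _)
  have key : ∀ s : Set X, ∫ x in s, (ψ x - ξ) ∂μ = ∫ x in s, ψ x ∂μ - μ.real s * ξ := by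
    intro s
    rw [integral_sub hi.integrableOn (integrable_const _).integrableOn]
    simp
  -- Since the two sets have equal measure, `ψ` may be replaced by `ψ - ξ`, which is positive on the
  -- superlevel set and nonpositive off it.
  have e : ∫ x in {x | ξ < ψ x}, ψ x ∂μ - ∫ x in ω, ψ x ∂μ =
      ∫ x in {x | ξ < ψ x}, (ψ x - ξ) ∂μ - ∫ x in ω, (ψ x - ξ) ∂μ := by
    rw [key, key, hm]
    ring
  rw [e, ← integral_indicator₀ hs, ← integral_indicator₀ hω, ← integral_indicator₀ (hs.symmDiff hω),
    ← integral_sub (hξ.indicator₀ hs) (hξ.indicator₀ hω)]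
  congr 1
  ext x
  by_cases h1 : ξ < ψ x <;> by_cases h2 : x ∈ ω
  · simp [Set.indicator, Set.mem_symmDiff, h1, h2]
  · simp [Set.indicator, Set.mem_symmDiff, h1, h2, abs_of_pos (sub_pos.2 h1)]
  · simp [Set.indicator, Set.mem_symmDiff, h1, h2, abs_of_nonpos (sub_nonpos.2 (not_lt.1 h1))]
  · simp [Set.indicator, Set.mem_symmDiff, h1, h2]

/-- The bathtub principle: superlevel sets are optimal. -/
theorem setIntegral_le_setIntegral_superlevel {ψ : X → ℝ} (hψ : Measurable ψ)
    (hi : Integrable ψ μ) {ξ : ℝ} {ω : Set X} (hω : NullMeasurableSet ω μ)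
    (hm : μ.real ω = μ.real {x | ξ < ψ x}) :
    ∫ x in ω, ψ x ∂μ ≤ ∫ x in {x | ξ < ψ x}, ψ x ∂μ := by
  have := setIntegral_superlevel_sub_setIntegral hψ hi hω hm
  have h0 : 0 ≤ ∫ x in symmDiff {x | ξ < ψ x} ω, |ψ x - ξ| ∂μ :=
    integral_nonneg fun x => abs_nonneg _
  linarith

/-- Stability in the bathtub principle: nearly optimal sets are close to the superlevel set. -/
theorem exists_pos_forall_measureReal_symmDiff_le {ψ : X → ℝ} (hψ : Measurable ψ)
    (hi : Integrable ψ μ) {ξ : ℝ} (hlev : μ {x | ψ x = ξ} = 0) {ε : ℝ} (hε : 0 < ε) :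
    ∃ δ > 0, ∀ ω : Set X, NullMeasurableSet ω μ → μ.real ω = μ.real {x | ξ < ψ x} →
      ∫ x in {x | ξ < ψ x}, ψ x ∂μ - ∫ x in ω, ψ x ∂μ ≤ δ →
      μ.real (symmDiff {x | ξ < ψ x} ω) ≤ ε := by
  have hmeas : ∀ η, MeasurableSet {x | |ψ x - ξ| ≤ η} := fun η =>
    measurableSet_le (hψ.sub measurable_const).abs measurable_const
  -- The layers around level `ξ` shrink to the level set, which is null. Off a layer of measure at
  -- most `ε / 2` the defect density exceeds `η`, so a defect of at most `η * (ε / 2)` leaves at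
  -- most another `ε / 2` of symmetric difference.
  obtain ⟨η, hη, hηε⟩ : ∃ η > 0, μ.real {x | |ψ x - ξ| ≤ η} ≤ ε / 2 := by
    have hanti : Antitone fun k : ℕ => {x | |ψ x - ξ| ≤ 1 / ((k : ℝ) + 1)} := by
      intro k l hkl x hx
      exact (show |ψ x - ξ| ≤ _ from hx).trans (Nat.one_div_le_one_div hkl)
    have ht := tendsto_measure_iInter_atTop (μ := μ)
      (fun k : ℕ => (hmeas (1 / ((k : ℝ) + 1))).nullMeasurableSet) hanti ⟨0, measure_ne_top _ _⟩
    have hI : (⋂ k : ℕ, {x | |ψ x - ξ| ≤ 1 / ((k : ℝ) + 1)}) ⊆ {x | ψ x = ξ} := by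
      intro x hx
      simp only [Set.mem_iInter, Set.mem_ofPred_eq] at hx
      have : |ψ x - ξ| ≤ 0 :=
        ge_of_tendsto' tendsto_one_div_add_atTop_nhds_zero_nat hx
      simpa [sub_eq_zero] using this
    rw [measure_mono_null hI hlev] at ht
    have ht' := (ENNReal.tendsto_toReal ENNReal.zero_ne_top).comp ht
    obtain ⟨k, hk⟩ := (ht'.eventually_lt_const (u := ε / 2) (by simpa using hε)).exists
    exact ⟨1 / ((k : ℝ) + 1), by positivity, hk.le⟩
  refine ⟨η * (ε / 2), by positivity, fun ω hω hm hle => ?_⟩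
  rw [setIntegral_superlevel_sub_setIntegral hψ hi hω hm] at hle
  set s := symmDiff {x | ξ < ψ x} ω with hs_def
  have hs : NullMeasurableSet s μ :=
    (measurableSet_lt measurable_const hψ).nullMeasurableSet.symmDiff hω
  have hint : Integrable (fun x => |ψ x - ξ|) μ := (hi.sub (integrable_const _)).abs
  have h1 : η * μ.real (s \ {x | |ψ x - ξ| ≤ η}) ≤ ∫ x in s, |ψ x - ξ| ∂μ := by
    calc η * μ.real (s \ {x | |ψ x - ξ| ≤ η})
        = ∫ x in s \ {x | |ψ x - ξ| ≤ η}, η ∂μ := by simp [mul_comm]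
      _ ≤ ∫ x in s \ {x | |ψ x - ξ| ≤ η}, |ψ x - ξ| ∂μ := by
          refine setIntegral_mono_on₀ (integrable_const _).integrableOn hint.integrableOn
            (hs.diff (hmeas η).nullMeasurableSet) fun x hx => ?_
          exact (not_le.1 hx.2).le
      _ ≤ ∫ x in s, |ψ x - ξ| ∂μ :=
          setIntegral_mono_set hint.integrableOn (ae_of_all _ fun x => abs_nonneg _)
            (Set.sdiff_subset.eventuallyLE)
  have h2 : μ.real (s \ {x | |ψ x - ξ| ≤ η}) ≤ ε / 2 :=
    le_of_mul_le_mul_left (h1.trans hle) hη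
  have h3 : μ.real s ≤ μ.real (s \ {x | |ψ x - ξ| ≤ η}) + μ.real {x | |ψ x - ξ| ≤ η} := by
    refine (measureReal_mono ?_).trans (measureReal_union_le _ _)
    intro x hx
    by_cases h : |ψ x - ξ| ≤ η
    · exact Or.inr h
    · exact Or.inl ⟨hx, h⟩
  linarith

/-- Uniqueness in the bathtub principle. -/
theorem ae_eq_superlevel_of_setIntegral_le {ψ : X → ℝ} (hψ : Measurable ψ)
    (hi : Integrable ψ μ) {ξ : ℝ} (hlev : μ {x | ψ x = ξ} = 0) {ω : Set X}
    (hω : NullMeasurableSet ω μ) (hm : μ.real ω = μ.real {x | ξ < ψ x})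
    (hle : ∫ x in {x | ξ < ψ x}, ψ x ∂μ ≤ ∫ x in ω, ψ x ∂μ) :
    ω =ᵐ[μ] {x | ξ < ψ x} := by
  have h0 : μ.real (symmDiff {x | ξ < ψ x} ω) ≤ 0 := by
    refine le_of_forall_pos_le_add fun ε hε => ?_
    obtain ⟨δ, hδ, h⟩ := exists_pos_forall_measureReal_symmDiff_le hψ hi hlev hε
    simpa using h ω hω hm (by linarith)
  have h1 : μ (symmDiff {x | ξ < ψ x} ω) = 0 :=
    (measureReal_eq_zero_iff).1 (le_antisymm h0 measureReal_nonneg)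
  exact (measure_symmDiff_eq_zero_iff.1 h1).symm

theorem abs_setIntegral_sub_setIntegral_le {g : X → ℝ} (hi : Integrable g μ) {C : ℝ}
    (hC : ∀ x, |g x| ≤ C) {s t : Set X} (hs : NullMeasurableSet s μ) (ht : NullMeasurableSet t μ) :
    |∫ x in s, g x ∂μ - ∫ x in t, g x ∂μ| ≤ C * μ.real (symmDiff s t) := by
  rw [← integral_indicator₀ hs, ← integral_indicator₀ ht,
    ← integral_sub (hi.indicator₀ hs) (hi.indicator₀ ht)]
  calc |∫ x, (s.indicator g x - t.indicator g x) ∂μ|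
      ≤ ∫ x, |s.indicator g x - t.indicator g x| ∂μ := abs_integral_le_integral_abs
    _ ≤ ∫ x, (symmDiff s t).indicator (fun _ => C) x ∂μ := by
        refine integral_mono ((hi.indicator₀ hs).sub (hi.indicator₀ ht)).abs
          ((integrable_const C).indicator₀ (hs.symmDiff ht)) fun x => ?_
        have := hC x
        by_cases h1 : x ∈ s <;> by_cases h2 : x ∈ t <;>
          simp [Set.indicator, Set.mem_symmDiff, h1, h2, this]
    _ = C * μ.real (symmDiff s t) := by
        rw [integral_indicator₀ (hs.symmDiff ht)]
        simp [mul_comm]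

/-- Maximin of finitely many linear functionals over sets of prescribed measure: if no
convex combination of the densities `g i` has a level set of positive measure, then a superlevel
set of one of them is the unique maximizer of `ω ↦ minᵢ ∫_ω g i`. -/
theorem exists_superlevel_unique_maximin {ι : Type*} [Fintype ι] [Nonempty ι] {g : ι → X → ℝ}
    (hg : ∀ i, Measurable (g i)) {C : ℝ} (hC0 : 0 ≤ C) (hC : ∀ i x, |g i x| ≤ C)
    (hlev : ∀ b ∈ stdSimplex ℝ ι, ∀ ξ, μ {x | ∑ i, b i * g i x = ξ} = 0) {m : ℝ}
    (hm : m ∈ Set.Icc 0 (μ.real Set.univ)) :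
    ∃ b ∈ stdSimplex ℝ ι, ∃ ξ, μ.real {x | ξ < ∑ i, b i * g i x} = m ∧
      ∀ ω : Set X, NullMeasurableSet ω μ → μ.real ω = m →
        ((⨅ i, ∫ x in ω, g i x ∂μ) ≤ ⨅ i, ∫ x in {x | ξ < ∑ i, b i * g i x}, g i x ∂μ) ∧
        ((⨅ i, ∫ x in ω, g i x ∂μ) = (⨅ i, ∫ x in {x | ξ < ∑ i, b i * g i x}, g i x ∂μ) →
          ω =ᵐ[μ] {x | ξ < ∑ i, b i * g i x}) := by
  classical
  have hgi : ∀ i, Integrable (g i) μ := fun i =>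
    Integrable.of_bound (hg i).aestronglyMeasurable C (ae_of_all _ fun x => hC i x)
  let ψ : (ι → ℝ) → X → ℝ := fun b x => ∑ i, b i * g i x
  have hψm : ∀ b, Measurable (ψ b) := fun b =>
    Finset.measurable_sum _ fun i _ => (hg i).const_mul (b i)
  have hψi : ∀ b, Integrable (ψ b) μ := fun b =>
    integrable_finsetSum _ fun i _ => (hgi i).const_mul (b i)
  have hψint : ∀ b (ω : Set X), ∫ x in ω, ψ b x ∂μ = ∑ i, b i * ∫ x in ω, g i x ∂μ := by
    intro b ω
    rw [integral_finsetSum _ fun i _ => ((hgi i).const_mul (b i)).integrableOn]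
    simp_rw [integral_const_mul]
  have hψC : ∀ b ∈ stdSimplex ℝ ι, ∀ x, |ψ b x| ≤ C := by
    intro b hb x
    calc |ψ b x| ≤ ∑ i, |b i * g i x| := Finset.abs_sum_le_sum_abs _ _
      _ ≤ ∑ i, b i * C := Finset.sum_le_sum fun i _ => by
          rw [abs_mul, abs_of_nonneg (hb.1 i)]
          exact mul_le_mul_of_nonneg_left (hC i x) (hb.1 i)
      _ = C := by rw [← Finset.sum_mul, hb.2, one_mul]
  let M := C * μ.real Set.univ
  have hcM : ∀ i (ω : Set X), |∫ x in ω, g i x ∂μ| ≤ M := by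
    intro i ω
    have h := norm_setIntegral_le_of_norm_le_const (μ := μ) (s := ω) (f := g i) (C := C)
      (measure_lt_top μ ω) (fun x _ => hC i x)
    exact h.trans (mul_le_mul_of_nonneg_left (measureReal_mono (Set.subset_univ _)) hC0)
  have hex : ∀ b ∈ stdSimplex ℝ ι, ∃ ξ, μ.real {x | ξ < ψ b x} = m := fun b hb =>
    exists_measureReal_superlevel_eq (hψm b) (hψC b hb) (hlev b hb) hm
  choose! ξ hξ using hex
  have hsm : ∀ b c, NullMeasurableSet {x | c < ψ b x} μ := fun b c =>
    (measurableSet_lt measurable_const (hψm b)).nullMeasurableSet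
  let A := {ω : Set X // NullMeasurableSet ω μ ∧ μ.real ω = m}
  let D : (ι → ℝ) → ℝ := fun b => ⨆ ω : A, ∑ i, b i * ∫ x in ω.1, g i x ∂μ
  have hbdd : ∀ b : ι → ℝ, BddAbove (Set.range fun ω : A => ∑ i, b i * ∫ x in ω.1, g i x ∂μ) := by
    intro b
    refine ⟨∑ i, |b i| * M, ?_⟩
    rintro _ ⟨ω, rfl⟩
    refine Finset.sum_le_sum fun i _ => (le_abs_self _).trans ?_
    rw [abs_mul]
    exact mul_le_mul_of_nonneg_left (hcM i _) (abs_nonneg _)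
  -- A supremum of linear functions of `b` is lower semicontinuous, which is all that is needed to
  -- attain a minimum on the compact simplex.
  have hlsc : LowerSemicontinuous D := lowerSemicontinuous_ciSup hbdd fun ω =>
    Continuous.lowerSemicontinuous (by fun_prop)
  have hle : ∀ b, ∀ ω : Set X, NullMeasurableSet ω μ → μ.real ω = m →
      ∫ x in ω, ψ b x ∂μ ≤ D b := by
    intro b ω h1 h2
    rw [hψint]
    exact le_ciSup (hbdd b) ⟨ω, h1, h2⟩
  have hD : ∀ b ∈ stdSimplex ℝ ι, D b = ∫ x in {x | ξ b < ψ b x}, ψ b x ∂μ := by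
    intro b hb
    refine le_antisymm ?_ (hle b _ (hsm b _) (hξ b hb))
    have : Nonempty A := ⟨⟨_, hsm b _, hξ b hb⟩⟩
    refine ciSup_le fun ω => ?_
    rw [← hψint]
    exact setIntegral_le_setIntegral_superlevel (hψm b) (hψi b) ω.2.1 (ω.2.2.trans (hξ b hb).symm)
  obtain ⟨i₀⟩ := ‹Nonempty ι›
  obtain ⟨b, hb, hmin⟩ := LowerSemicontinuousOn.exists_isMinOn
    ⟨Pi.single i₀ 1, single_mem_stdSimplex ℝ i₀⟩ (isCompact_stdSimplex ℝ ι)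
    (hlsc.lowerSemicontinuousOn _)
  set Ω := {x | ξ b < ψ b x} with hΩ
  -- First-order condition at the minimizer: move `b` by a small `t` towards vertex `i`, with
  -- optimal set `W`. Minimality forces `∫_W g i ≥ D b`, while small `t` makes `W` nearly optimal
  -- for `ψ b`. Stability then puts `W` close to `Ω`, so `∫_Ω g i` cannot lie below `D b` by the gap
  -- `c`.
  have hopt : ∀ i, D b ≤ ∫ x in Ω, g i x ∂μ := by
    intro i
    by_contra! hlt
    set c := D b - ∫ x in Ω, g i x ∂μ with hc
    have hcpos : 0 < c := sub_pos.2 hlt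
    -- This `ε` keeps the change of `∫ g i` within `c / 2`; the `+ 1` covers `C = 0`.
    obtain ⟨δ, hδ, hst⟩ := exists_pos_forall_measureReal_symmDiff_le (hψm b) (hψi b)
      (hlev b hb (ξ b)) (ε := c / (2 * (C + 1))) (by positivity)
    have hM0 : 0 ≤ M := by positivity
    obtain ⟨t, ht0, ht1, htδ⟩ : ∃ t : ℝ, 0 < t ∧ t ≤ 1 ∧ t * (2 * M) ≤ δ := by
      refine ⟨min 1 (δ / (2 * M + 1)), by positivity, min_le_left _ _, ?_⟩
      calc min 1 (δ / (2 * M + 1)) * (2 * M) ≤ δ / (2 * M + 1) * (2 * M + 1) := by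
            gcongr
            · exact min_le_right _ _
            · linarith
        _ = δ := by field_simp
    let bt : ι → ℝ := (1 - t) • b + t • Pi.single i 1
    have hbt : bt ∈ stdSimplex ℝ ι :=
      convex_stdSimplex ℝ ι hb (single_mem_stdSimplex ℝ i) (by linarith) ht0.le (by ring)
    set W := {x | ξ bt < ψ bt x} with hW
    have hWn : NullMeasurableSet W μ := hsm _ _
    have hWm : μ.real W = m := hξ bt hbt
    have hsplit : ∫ x in W, ψ bt x ∂μ =
        (1 - t) * ∫ x in W, ψ b x ∂μ + t * ∫ x in W, g i x ∂μ := by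
      rw [hψint, hψint]
      simp [bt, add_mul, Finset.sum_add_distrib, Finset.mul_sum, Pi.single_apply, mul_assoc]
    have h1 : D b ≤ ∫ x in W, ψ bt x ∂μ := by
      rw [← hD bt hbt]
      exact hmin hbt
    have h2 : ∫ x in W, ψ b x ∂μ ≤ D b := hle b W hWn hWm
    have h3 : D b ≤ ∫ x in W, g i x ∂μ := by
      have : t * D b ≤ t * ∫ x in W, g i x ∂μ := by
        nlinarith [mul_le_mul_of_nonneg_left h2 (sub_nonneg.2 ht1)]
      exact le_of_mul_le_mul_left this ht0
    have h4 : -M ≤ ∫ x in W, ψ b x ∂μ := by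
      rw [hψint]
      calc -M = ∑ i, b i * -M := by rw [← Finset.sum_mul, hb.2, one_mul]
        _ ≤ _ := Finset.sum_le_sum fun k _ =>
          mul_le_mul_of_nonneg_left (abs_le.1 (hcM k W)).1 (hb.1 k)
    have h5 : D b - ∫ x in W, ψ b x ∂μ ≤ δ := by
      have := (abs_le.1 (hcM i W)).2
      nlinarith
    have h6 := hst W hWn (hWm.trans (hξ b hb).symm) (by rwa [← hD b hb])
    have h7 := abs_setIntegral_sub_setIntegral_le (hgi i) (hC i) hWn (hsm b (ξ b))
    rw [symmDiff_comm] at h7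
    have h8 : C * μ.real (symmDiff Ω W) ≤ c / 2 := by
      calc C * μ.real (symmDiff Ω W) ≤ (C + 1) * (c / (2 * (C + 1))) := by
            gcongr
            linarith
        _ = c / 2 := by field_simp
    have h9 := (abs_le.1 h7).2
    linarith
  have hupper : ∀ ω : Set X, (⨅ i, ∫ x in ω, g i x ∂μ) ≤ ∫ x in ω, ψ b x ∂μ := by
    intro ω
    rw [hψint]
    calc (⨅ i, ∫ x in ω, g i x ∂μ) = ∑ i, b i * ⨅ i, ∫ x in ω, g i x ∂μ := by
          rw [← Finset.sum_mul, hb.2, one_mul]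
      _ ≤ _ := Finset.sum_le_sum fun k _ =>
          mul_le_mul_of_nonneg_left (ciInf_le (Set.finite_range _).bddBelow k) (hb.1 k)
  have : Nonempty ι := ⟨i₀⟩
  -- There is no duality gap: the minimum for any `ω` is at most `∫_ω ψ b ≤ D b`, and `Ω` reaches `D
  -- b`. Equality makes `ω` bathtub-optimal for `ψ b`, whence uniqueness.
  have hlower : D b ≤ ⨅ i, ∫ x in Ω, g i x ∂μ := le_ciInf hopt
  refine ⟨b, hb, ξ b, hξ b hb, fun ω hω hωm => ⟨?_, fun heq => ?_⟩⟩
  · exact (hupper ω).trans ((hle b ω hω hωm).trans hlower)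
  · refine ae_eq_superlevel_of_setIntegral_le (hψm b) (hψi b) (hlev b hb _) hω
      (hωm.trans (hξ b hb).symm) ?_
    rw [← hD b hb]
    exact (hlower.trans heq.ge).trans (hupper ω)

end Bathtub

/-! ### The function `f` and its iterates -/

/-- The function `f(u) = F(π u) = u - sin(π u)/π`. -/
noncomputable abbrev sineStep (u : ℝ) : ℝ := sineGap (Real.pi * u)

theorem sineStep_eq (u : ℝ) : sineStep u = u - Real.sin (Real.pi * u) / Real.pi := by
  have := Real.pi_ne_zero
  simp only [sineStep, sineGap]
  field_simp

theorem continuous_sineStep : Continuous sineStep := by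
  unfold sineStep sineGap
  fun_prop

/-- Sine is 1-Lipschitz, so `s - sin s` is nondecreasing on the whole line. -/
theorem monotone_sineStep : Monotone sineStep := by
  intro u v huv
  have h := Real.lipschitzWith_sin.dist_le_mul (Real.pi * v) (Real.pi * u)
  have h1 : Real.pi * u ≤ Real.pi * v := mul_le_mul_of_nonneg_left huv Real.pi_pos.le
  rw [Real.dist_eq, Real.dist_eq, abs_of_nonneg (sub_nonneg.2 h1)] at h
  have h2 := (abs_le.1 h).2
  simp only [sineStep, sineGap]
  gcongr ?_ / _
  simp at h2
  linarith

theorem sineStep_zero : sineStep 0 = 0 := by simp [sineStep, sineGap]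

theorem sineStep_one : sineStep 1 = 1 := by simp [sineStep_eq]

theorem sineStep_pos {u : ℝ} (hu : 0 < u) : 0 < sineStep u :=
  div_pos (sub_pos.2 (Real.sin_lt (mul_pos Real.pi_pos hu))) Real.pi_pos

theorem mapsTo_sineStep : Set.MapsTo sineStep (Set.Icc 0 1) (Set.Icc 0 1) := fun _ hu =>
  ⟨sineStep_zero ▸ monotone_sineStep hu.1, sineStep_one ▸ monotone_sineStep hu.2⟩

theorem convexOn_sineStep : ConvexOn ℝ (Set.Icc 0 1) sineStep := by
  refine ⟨convex_Icc 0 1, fun u hu v hv a b ha hb hab => ?_⟩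
  have hm : ∀ w ∈ Set.Icc (0 : ℝ) 1, Real.pi * w ∈ Set.Icc 0 Real.pi := fun w hw =>
    ⟨mul_nonneg Real.pi_pos.le hw.1, mul_le_of_le_one_right Real.pi_pos.le hw.2⟩
  have h := strictConcaveOn_sin_Icc.concaveOn.2 (hm u hu) (hm v hv) ha hb hab
  have e : a • (Real.pi * u) + b • (Real.pi * v) = Real.pi * (a • u + b • v) := by
    simp only [smul_eq_mul]
    ring
  rw [e] at h
  simp only [smul_eq_mul, sineStep, sineGap] at h ⊢
  rw [mul_div_assoc', mul_div_assoc', ← add_div]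
  gcongr ?_ / _
  linarith

theorem continuous_iterate_sineStep (n : ℕ) : Continuous sineStep^[n] :=
  continuous_sineStep.iterate n

theorem mapsTo_iterate_sineStep (n : ℕ) :
    Set.MapsTo sineStep^[n] (Set.Icc 0 1) (Set.Icc 0 1) :=
  mapsTo_sineStep.iterate n

theorem iterate_sineStep_pos (n : ℕ) {u : ℝ} (hu : 0 < u) : 0 < sineStep^[n] u := by
  induction n with
  | zero => exact hu
  | succ n ih =>
    rw [Function.iterate_succ_apply']
    exact sineStep_pos ih

/-- A nondecreasing convex function of a convex one is convex; invariance of `[0, 1]` matters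
because `f` inherits convexity from the concavity of sine on `[0, π]` only. -/
theorem convexOn_iterate_sineStep (n : ℕ) : ConvexOn ℝ (Set.Icc 0 1) sineStep^[n] := by
  induction n with
  | zero => exact convexOn_id (convex_Icc 0 1)
  | succ n ih =>
    rw [Function.iterate_succ']
    refine ⟨convex_Icc 0 1, fun u hu v hv a b ha hb hab => ?_⟩
    exact (monotone_sineStep (ih.2 hu hv ha hb hab)).trans
      (convexOn_sineStep.2 (mapsTo_iterate_sineStep n hu) (mapsTo_iterate_sineStep n hv) ha hb hab)

/-! ### The lower bound in dimension one -/

theorem intervalIntegral_posPart_cos_sub {s : ℝ} (hs : s ∈ Set.Icc 0 Real.pi) :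
    ∫ y in (-Real.pi)..Real.pi, max (Real.cos y - Real.cos s) 0 =
      2 * (Real.sin s - s * Real.cos s) := by
  have hc : Continuous fun y => max (Real.cos y - Real.cos s) 0 := by fun_prop
  have hii : ∀ a b, IntervalIntegrable (fun y => max (Real.cos y - Real.cos s) 0) volume a b :=
    fun a b => hc.intervalIntegrable a b
  have hout : ∀ y, s ≤ |y| → |y| ≤ Real.pi → max (Real.cos y - Real.cos s) 0 = 0 := by
    intro y h1 h2
    refine max_eq_right (sub_nonpos.2 ?_)
    rw [← Real.cos_abs y]
    exact Real.cos_le_cos_of_nonneg_of_le_pi hs.1 h2 h1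
  have hin : ∀ y, |y| ≤ s → max (Real.cos y - Real.cos s) 0 = Real.cos y - Real.cos s := by
    intro y h1
    refine max_eq_left (sub_nonneg.2 ?_)
    rw [← Real.cos_abs y]
    exact Real.cos_le_cos_of_nonneg_of_le_pi (abs_nonneg _) hs.2 h1
  have h1 : ∫ y in (-Real.pi)..(-s), max (Real.cos y - Real.cos s) 0 = 0 := by
    rw [intervalIntegral.integral_congr (g := fun _ => (0 : ℝ)), intervalIntegral.integral_zero]
    intro y hy
    rw [Set.uIcc_of_le (neg_le_neg hs.2)] at hy
    have h0 : |y| = -y := abs_of_nonpos (by linarith [hy.2, hs.1])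
    exact hout y (by linarith [hy.2]) (by linarith [hy.1])
  have h2 : ∫ y in s..Real.pi, max (Real.cos y - Real.cos s) 0 = 0 := by
    rw [intervalIntegral.integral_congr (g := fun _ => (0 : ℝ)), intervalIntegral.integral_zero]
    intro y hy
    rw [Set.uIcc_of_le hs.2] at hy
    have h0 : |y| = y := abs_of_nonneg (by linarith [hy.1, hs.1])
    exact hout y (by linarith [hy.1]) (by linarith [hy.2])
  have h3 : ∫ y in (-s)..s, max (Real.cos y - Real.cos s) 0 =
      2 * (Real.sin s - s * Real.cos s) := by
    rw [intervalIntegral.integral_congr (g := fun y => Real.cos y - Real.cos s),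
      intervalIntegral.integral_sub (by simp) (by simp)]
    · simp
      ring
    · intro y hy
      rw [Set.uIcc_of_le (by linarith [hs.1])] at hy
      exact hin y (abs_le.2 hy)
  rw [← intervalIntegral.integral_add_adjacent_intervals (hii _ (-s)) (hii _ _),
    ← intervalIntegral.integral_add_adjacent_intervals (hii (-s) s) (hii _ _), h1, h2, h3]
  ring

/-- The substitution `y = 2 j x` covers `j` full periods, so the factor `j` cancels. This is why the
lower bound is uniform in the mode. -/
theorem intervalIntegral_posPart_cos_mul_sub (j : ℕ+) {s : ℝ} (hs : s ∈ Set.Icc 0 Real.pi) :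
    ∫ x in (0 : ℝ)..Real.pi, max (Real.cos (2 * j * x) - Real.cos s) 0 =
      Real.sin s - s * Real.cos s := by
  have hj : (0 : ℝ) < j := by exact_mod_cast j.pos
  have hc : Continuous fun y => max (Real.cos y - Real.cos s) 0 := by fun_prop
  have hper : Function.Periodic (fun y => max (Real.cos y - Real.cos s) 0) (2 * Real.pi) := by
    intro y
    simp
  have h1 := intervalIntegral.integral_comp_mul_left
    (f := fun y => max (Real.cos y - Real.cos s) 0) (a := 0) (b := Real.pi)
    (c := 2 * (j : ℝ)) (by positivity)
  have h2 := hper.intervalIntegral_add_zsmul_eq (j : ℕ) 0 (fun a b => hc.intervalIntegrable a b)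
  have h3 := hper.intervalIntegral_add_eq 0 (-Real.pi)
  rw [h3, show -Real.pi + 2 * Real.pi = Real.pi by ring, intervalIntegral_posPart_cos_sub hs] at h2
  have e : (0 : ℝ) + ((j : ℕ) : ℤ) • (2 * Real.pi) = 2 * (j : ℝ) * Real.pi := by
    simp
    ring
  rw [e] at h2
  rw [h1, mul_zero, h2]
  simp
  field_simp

/-- Lebesgue measure on `(0, π)`. -/
noncomputable abbrev arcMeasure : Measure ℝ := volume.restrict (Set.Ioo 0 Real.pi)

theorem arcMeasure_real_univ : arcMeasure.real Set.univ = Real.pi := by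
  simp [Measure.real, Real.pi_pos.le]

/-- One-dimensional lower bound: among densities of prescribed mass, `∫ ρ (2/π) sin²(j x) dx` is
at least `F(∫ ρ)`. -/
theorem sineGap_integral_le (j : ℕ+) {ρ : ℝ → ℝ} (hρ : Measurable ρ)
    (h01 : ∀ x, ρ x ∈ Set.Icc (0 : ℝ) 1) :
    sineGap (∫ x, ρ x ∂arcMeasure) ≤
      ∫ x, ρ x * (2 / Real.pi * Real.sin (j * x) ^ 2) ∂arcMeasure := by
  have hpi := Real.pi_pos
  set s := ∫ x, ρ x ∂arcMeasure with hs_def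
  have hbd : ∀ {h : ℝ → ℝ} (c : ℝ), Measurable h → (∀ x, |h x| ≤ c) → Integrable h arcMeasure :=
    fun c hm hc => Integrable.of_bound hm.aestronglyMeasurable c (ae_of_all _ hc)
  have hρi : Integrable ρ arcMeasure :=
    hbd 1 hρ fun x => abs_le.2 ⟨by linarith [(h01 x).1], (h01 x).2⟩
  have hs : s ∈ Set.Icc 0 Real.pi := by
    refine ⟨integral_nonneg fun x => (h01 x).1, ?_⟩
    calc s ≤ ∫ x, (1 : ℝ) ∂arcMeasure := integral_mono hρi (integrable_const _) fun x => (h01 x).2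
      _ = Real.pi := by
        rw [integral_const, arcMeasure_real_univ]
        simp
  set P : ℝ → ℝ := fun x => max (Real.cos (2 * j * x) - Real.cos s) 0 with hP
  have hPint : ∫ x, P x ∂arcMeasure = Real.sin s - s * Real.cos s := by
    rw [← intervalIntegral_posPart_cos_mul_sub j hs, intervalIntegral.integral_of_le hpi.le,
      integral_Ioc_eq_integral_Ioo]
  have hPm : Measurable P := by
    have : Continuous P := by fun_prop
    exact this.measurable
  have hPi : Integrable P arcMeasure := by
    refine hbd 2 hPm fun x => ?_
    rw [abs_of_nonneg (le_max_right _ _)]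
    exact max_le (by linarith [Real.cos_le_one (2 * j * x), Real.neg_one_le_cos s]) (by norm_num)
  have hwi : Integrable (fun x => ρ x * (2 / Real.pi * Real.sin (j * x) ^ 2)) arcMeasure := by
    refine hbd (2 / Real.pi) (by fun_prop) fun x => ?_
    rw [abs_of_nonneg (mul_nonneg (h01 x).1 (by positivity))]
    calc ρ x * (2 / Real.pi * Real.sin (j * x) ^ 2) ≤ 1 * (2 / Real.pi * 1) := by
          gcongr
          · exact (h01 x).2
          · exact Real.sin_sq_le_one _
      _ = 2 / Real.pi := by ring
  -- The threshold `cos s` is the optimal one: `cos (2 j x) > cos s` on a set of measure `s` in `(0,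
  -- π)`, the mass of `ρ`.
  have hpt : ∀ x, ((1 - Real.cos s) / Real.pi) * ρ x - (1 / Real.pi) * P x ≤
      ρ x * (2 / Real.pi * Real.sin (j * x) ^ 2) := by
    intro x
    have h1 : Real.cos (2 * j * x) - Real.cos s ≤ P x := le_max_left _ _
    have h2 : 0 ≤ P x := le_max_right _ _
    have h3 : ρ x * (Real.cos (2 * j * x) - Real.cos s) ≤ P x :=
      (mul_le_mul_of_nonneg_left h1 (h01 x).1).trans (mul_le_of_le_one_left h2 (h01 x).2)
    have h4 : Real.sin (j * x) ^ 2 = 1 / 2 - Real.cos (2 * j * x) / 2 := by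
      rw [Real.sin_sq_eq_half_sub, mul_assoc]
    rw [h4, ← sub_nonneg]
    have : ρ x * (2 / Real.pi * (1 / 2 - Real.cos (2 * j * x) / 2)) -
        ((1 - Real.cos s) / Real.pi * ρ x - 1 / Real.pi * P x) =
        (P x - ρ x * (Real.cos (2 * j * x) - Real.cos s)) / Real.pi := by
      field_simp
      ring
    rw [this]
    exact div_nonneg (sub_nonneg.2 h3) hpi.le
  have := integral_mono ((hρi.const_mul _).sub (hPi.const_mul _)) hwi hpt
  simp only [Pi.sub_apply] at this
  rw [integral_sub (hρi.const_mul _) (hPi.const_mul _), integral_const_mul, integral_const_mul,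
    hPint, ← hs_def] at this
  refine le_trans (le_of_eq ?_) this
  simp only [sineGap]
  field_simp
  ring

/-! ### The lower bound in dimension `n` -/

/-- Lebesgue measure on `(0, π)ⁿ`, as a product measure. -/
noncomputable abbrev boxMeasure (n : ℕ) : Measure (Fin n → ℝ) := Measure.pi fun _ => arcMeasure

theorem volume_restrict_orthotope (n : ℕ) : volume.restrict (orthotope n) = boxMeasure n := by
  rw [orthotope, volume_pi, Measure.restrict_pi_pi]

theorem boxMeasure_real_univ (n : ℕ) : (boxMeasure n).real Set.univ = Real.pi ^ n := by
  simp [Measure.real, Measure.pi_univ, Real.pi_pos.le]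

theorem sineMode_sq {n : ℕ} (j : Fin n → ℕ+) (x : Fin n → ℝ) :
    sineMode j x ^ 2 = ∏ k, (2 / Real.pi * Real.sin (j k * x k) ^ 2) := by
  have h : ((2 / Real.pi) ^ ((n : ℝ) / 2)) ^ 2 = (2 / Real.pi) ^ n := by
    rw [← Real.rpow_natCast, ← Real.rpow_mul (by positivity)]
    simp
  rw [sineMode, mul_pow, h, Finset.prod_mul_distrib, Finset.prod_pow,
    Finset.prod_const, Finset.card_univ, Fintype.card_fin]

theorem continuous_sineMode {n : ℕ} (j : Fin n → ℕ+) : Continuous (sineMode j) := by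
  unfold sineMode
  fun_prop

theorem sineMode_sq_le {n : ℕ} (j : Fin n → ℕ+) (x : Fin n → ℝ) :
    sineMode j x ^ 2 ≤ (2 / Real.pi) ^ n := by
  rw [sineMode_sq]
  calc ∏ k, (2 / Real.pi * Real.sin (j k * x k) ^ 2) ≤ ∏ _k : Fin n, (2 / Real.pi) := by
        have := Real.pi_pos
        refine Finset.prod_le_prod (fun k _ => by positivity) fun k _ => ?_
        exact mul_le_of_le_one_right (by positivity) (Real.sin_sq_le_one _)
    _ = (2 / Real.pi) ^ n := by rw [Finset.prod_const, Finset.card_univ, Fintype.card_fin]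

theorem integrable_boxMeasure_of_bound {n : ℕ} {h : (Fin n → ℝ) → ℝ} {c : ℝ} (hm : Measurable h)
    (hc : ∀ x, |h x| ≤ c) : Integrable h (boxMeasure n) :=
  Integrable.of_bound hm.aestronglyMeasurable c (ae_of_all _ hc)

theorem integral_boxMeasure_succ {n : ℕ} {h : (Fin (n + 1) → ℝ) → ℝ} {c : ℝ} (hm : Measurable h)
    (hc : ∀ x, |h x| ≤ c) :
    Integrable (fun s => ∫ y, h (Fin.cons s y) ∂boxMeasure n) arcMeasure ∧
    ∫ x, h x ∂boxMeasure (n + 1) = ∫ s, ∫ y, h (Fin.cons s y) ∂boxMeasure n ∂arcMeasure := by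
  have hcons : Measurable fun p : ℝ × (Fin n → ℝ) => (Fin.cons p.1 p.2 : Fin (n + 1) → ℝ) := by
    have : Continuous fun p : ℝ × (Fin n → ℝ) => (Fin.cons p.1 p.2 : Fin (n + 1) → ℝ) := by
      fun_prop
    exact this.measurable
  have hi : Integrable (fun p : ℝ × (Fin n → ℝ) => h (Fin.cons p.1 p.2))
      (arcMeasure.prod (boxMeasure n)) :=
    Integrable.of_bound (hm.comp hcons).aestronglyMeasurable c (ae_of_all _ fun p => hc _)
  refine ⟨hi.integral_prod_left, ?_⟩
  rw [← integral_prod _ hi]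
  have hmp := measurePreserving_piFinSuccAbove (fun _ : Fin (n + 1) => arcMeasure) 0
  rw [← hmp.integral_comp']
  congr 1
  ext x
  simp [MeasurableEquiv.piFinSuccAbove, Fin.insertNthEquiv]

theorem iterate_sineStep_le_integral {n : ℕ} (j : Fin n → ℕ+) {ρ : (Fin n → ℝ) → ℝ}
    (hρ : Measurable ρ) (h01 : ∀ x, ρ x ∈ Set.Icc (0 : ℝ) 1) :
    sineStep^[n] ((∫ x, ρ x ∂boxMeasure n) / Real.pi ^ n) ≤
      ∫ x, ρ x * sineMode j x ^ 2 ∂boxMeasure n := by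
  have hpi := Real.pi_pos
  induction n with
  | zero => simp [sineMode_sq]
  | succ n ih =>
    have hcons : ∀ s : ℝ, Measurable fun y : Fin n → ℝ => (Fin.cons s y : Fin (n + 1) → ℝ) := by
      intro s
      have : Continuous fun y : Fin n → ℝ => (Fin.cons s y : Fin (n + 1) → ℝ) := by fun_prop
      exact this.measurable
    have habs : ∀ x, |ρ x| ≤ 1 := fun x => abs_le.2 ⟨by linarith [(h01 x).1], (h01 x).2⟩
    have he1 := (integral_boxMeasure_succ hρ habs).2
    have hρφ : Measurable fun x => ρ x * sineMode j x ^ 2 :=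
      hρ.mul ((continuous_sineMode j).measurable.pow_const 2)
    obtain ⟨hi2, he2⟩ := integral_boxMeasure_succ hρφ (c := (2 / Real.pi) ^ (n + 1)) fun x => by
      rw [abs_of_nonneg (mul_nonneg (h01 x).1 (sq_nonneg _))]
      exact (mul_le_of_le_one_left (sq_nonneg _) (h01 x).2).trans (sineMode_sq_le j x)
    let m : ℝ → ℝ := fun s => (∫ y, ρ (Fin.cons s y) ∂boxMeasure n) / Real.pi ^ n
    have hm01 : ∀ s, m s ∈ Set.Icc (0 : ℝ) 1 := by
      intro s
      refine ⟨div_nonneg (integral_nonneg fun y => (h01 _).1) (by positivity), ?_⟩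
      rw [div_le_one (by positivity)]
      calc ∫ y, ρ (Fin.cons s y) ∂boxMeasure n ≤ ∫ _y, (1 : ℝ) ∂boxMeasure n :=
            integral_mono (integrable_boxMeasure_of_bound (hρ.comp (hcons s)) fun y => habs _)
              (integrable_const _) fun y => (h01 _).2
        _ = Real.pi ^ n := by
            rw [integral_const, boxMeasure_real_univ]
            simp
    have hmm : Measurable m := by
      have h1 : StronglyMeasurable fun s => ∫ y, ρ (Fin.cons s y) ∂boxMeasure n := by
        refine StronglyMeasurable.integral_prod_right'
          (f := fun (p : ℝ × (Fin n → ℝ)) => ρ (Fin.cons p.1 p.2)) ?_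
        have : Continuous fun p : ℝ × (Fin n → ℝ) => (Fin.cons p.1 p.2 : Fin (n + 1) → ℝ) := by
          fun_prop
        exact (hρ.comp this.measurable).stronglyMeasurable
      exact h1.measurable.div_const _
    -- The induction hypothesis bounds the slice integral below by `r s` times the first sine
    -- factor. Since `r` again takes values in `[0, 1]`, it is an admissible density for the
    -- one-dimensional bound.
    let r : ℝ → ℝ := fun s => sineStep^[n] (m s)
    have hrm : Measurable r := (continuous_iterate_sineStep n).measurable.comp hmm
    have hr01 : ∀ s, r s ∈ Set.Icc (0 : ℝ) 1 := fun s => mapsTo_iterate_sineStep n (hm01 s)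
    have hbd : ∀ {h : ℝ → ℝ} (c : ℝ), Measurable h → (∀ x, |h x| ≤ c) → Integrable h arcMeasure :=
      fun c hm hc => Integrable.of_bound hm.aestronglyMeasurable c (ae_of_all _ hc)
    have hri : Integrable r arcMeasure :=
      hbd 1 hrm fun x => abs_le.2 ⟨by linarith [(hr01 x).1], (hr01 x).2⟩
    have hmi : Integrable m arcMeasure :=
      hbd 1 hmm fun x => abs_le.2 ⟨by linarith [(hm01 x).1], (hm01 x).2⟩
    have hne : NeZero arcMeasure := ⟨fun h => by
      have := arcMeasure_real_univ
      rw [h] at this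
      simp at this
      exact hpi.ne this⟩
    have hjensen := (convexOn_iterate_sineStep n).map_average_le
      (continuous_iterate_sineStep n).continuousOn isClosed_Icc (ae_of_all _ hm01) hmi hri
    rw [average_eq, average_eq, arcMeasure_real_univ] at hjensen
    have hmean : (∫ x, ρ x ∂boxMeasure (n + 1)) / Real.pi ^ (n + 1) =
        Real.pi⁻¹ • ∫ s, m s ∂arcMeasure := by
      rw [he1, integral_div, smul_eq_mul]
      field_simp
      ring
    have hslice : ∀ s, r s * (2 / Real.pi * Real.sin (j 0 * s) ^ 2) ≤
        ∫ y, ρ (Fin.cons s y) * sineMode j (Fin.cons s y) ^ 2 ∂boxMeasure n := by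
      intro s
      have h1 := ih (fun k => j k.succ) (hρ.comp (hcons s)) (fun y => h01 _)
      have h2 : ∀ y : Fin n → ℝ, ρ (Fin.cons s y) * sineMode j (Fin.cons s y) ^ 2 =
          (ρ (Fin.cons s y) * sineMode (fun k => j k.succ) y ^ 2) *
            (2 / Real.pi * Real.sin (j 0 * s) ^ 2) := by
        intro y
        rw [sineMode_sq, sineMode_sq, Fin.prod_univ_succ]
        simp only [Fin.cons_zero, Fin.cons_succ]
        ring
      simp_rw [h2]
      rw [integral_mul_const]
      exact mul_le_mul_of_nonneg_right h1 (by positivity)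
    have hwi : Integrable (fun s => r s * (2 / Real.pi * Real.sin (j 0 * s) ^ 2)) arcMeasure := by
      refine hbd (2 / Real.pi) (by fun_prop) fun x => ?_
      rw [abs_of_nonneg (mul_nonneg (hr01 x).1 (by positivity))]
      refine (mul_le_of_le_one_left (by positivity) (hr01 x).2).trans ?_
      exact mul_le_of_le_one_right (by positivity) (Real.sin_sq_le_one _)
    calc sineStep^[n + 1] ((∫ x, ρ x ∂boxMeasure (n + 1)) / Real.pi ^ (n + 1))
        = sineStep (sineStep^[n] (Real.pi⁻¹ • ∫ s, m s ∂arcMeasure)) := by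
          rw [Function.iterate_succ_apply', hmean]
      _ ≤ sineStep (Real.pi⁻¹ • ∫ s, r s ∂arcMeasure) := monotone_sineStep hjensen
      _ = sineGap (∫ s, r s ∂arcMeasure) := by
          rw [sineStep, smul_eq_mul, mul_inv_cancel_left₀ hpi.ne']
      _ ≤ ∫ s, r s * (2 / Real.pi * Real.sin (j 0 * s) ^ 2) ∂arcMeasure :=
          sineGap_integral_le (j 0) hrm hr01
      _ ≤ ∫ s, ∫ y, ρ (Fin.cons s y) * sineMode j (Fin.cons s y) ^ 2 ∂boxMeasure n ∂arcMeasure :=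
          integral_mono hwi hi2 hslice
      _ = ∫ x, ρ x * sineMode j x ^ 2 ∂boxMeasure (n + 1) := he2.symm

/-- The uniform lower bound for densities. -/
theorem sineLowerBound_le_integral {n : ℕ} (j : Fin n → ℕ+) {ρ : (Fin n → ℝ) → ℝ}
    (hρ : IsDensity n ρ) :
    sineLowerBound n (∫ x in orthotope n, ρ x) ≤
      ∫ x in orthotope n, ρ x * sineMode j x ^ 2 := by
  obtain ⟨hm, h01⟩ := hρ
  rw [volume_restrict_orthotope] at *
  -- Clamping a measurable representative makes the constraints hold everywhere, as slicing
  -- requires.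
  let ρ' : (Fin n → ℝ) → ℝ := fun x => max 0 (min 1 (hm.mk ρ x))
  have hρ' : ρ =ᵐ[boxMeasure n] ρ' := by
    filter_upwards [h01, hm.ae_eq_mk] with x hx he
    simp only [ρ']
    rw [← he, min_eq_right hx.2, max_eq_right hx.1]
  have hmeas : Measurable ρ' := by
    have := hm.stronglyMeasurable_mk.measurable
    fun_prop
  have h := iterate_sineStep_le_integral j hmeas
    (fun x => ⟨le_max_left _ _, max_le zero_le_one (min_le_left _ _)⟩)
  have h2 : (fun x => ρ x * sineMode j x ^ 2) =ᵐ[boxMeasure n] fun x => ρ' x * sineMode j x ^ 2 :=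
    hρ'.mul EventuallyEq.rfl
  rw [integral_congr_ae hρ', integral_congr_ae h2]
  exact h

theorem sineLowerBound_pos (n : ℕ) {s : ℝ} (hs : 0 < s) : 0 < sineLowerBound n s :=
  iterate_sineStep_pos n (div_pos hs (pow_pos Real.pi_pos n))

theorem integral_sineMode_one_sq (n : ℕ) :
    ∫ x in orthotope n, sineMode (fun _ => 1) x ^ 2 = 1 := by
  have h1 : ∫ x, 2 / Real.pi * Real.sin x ^ 2 ∂arcMeasure = 1 := by
    rw [← integral_Ioc_eq_integral_Ioo, ← intervalIntegral.integral_of_le Real.pi_pos.le,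
      intervalIntegral.integral_const_mul, integral_sin_sq]
    simp
  rw [volume_restrict_orthotope]
  simp_rw [sineMode_sq]
  simp only [PNat.one_coe, Nat.cast_one, one_mul]
  rw [integral_fintype_prod_eq_pow (fun y => 2 / Real.pi * Real.sin y ^ 2), h1, one_pow]

/-! ### Growth of the weights and ordering of the modes -/

section Weights

/-- The weight is `T` times the slope of the secant of `exp` between `0` and `2 l T`, which
increases by convexity. -/
theorem timeWeight_le_timeWeight {l l' T : ℝ} (hl : 0 < l) (hll : l ≤ l') (hT : 0 < T) :
    timeWeight l T ≤ timeWeight l' T := by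
  have hl' : 0 < l' := hl.trans_le hll
  rw [timeWeight, timeWeight, if_neg hl.ne', if_neg hl'.ne']
  have h := convexOn_exp.secant_mono (Set.mem_univ (0 : ℝ)) (Set.mem_univ (2 * l * T))
    (Set.mem_univ (2 * l' * T)) (by positivity) (by positivity) (by gcongr)
  simp only [Real.exp_zero, sub_zero] at h
  have e : ∀ c : ℝ, 0 < c → (Real.exp (2 * c * T) - 1) / (2 * c) =
      T * ((Real.exp (2 * c * T) - 1) / (2 * c * T)) := by
    intro c hc
    field_simp
  rw [e l hl, e l' hl']
  exact mul_le_mul_of_nonneg_left h hT.le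

theorem add_le_timeWeight {l T : ℝ} (hl : 0 < l) (hT : 0 < T) :
    T + l * T ^ 2 ≤ timeWeight l T := by
  rw [timeWeight, if_neg hl.ne', le_div_iff₀ (by positivity)]
  have := Real.quadratic_le_exp_of_nonneg (x := 2 * l * T) (by positivity)
  nlinarith

variable {n : ℕ} {α T : ℝ}

theorem modeEigenvalue_pos (hn : 1 ≤ n) (j : Fin n → ℕ+) : 0 < modeEigenvalue α j := by
  have : Nonempty (Fin n) := ⟨⟨0, hn⟩⟩
  refine Real.rpow_pos_of_pos (Finset.sum_pos (fun k _ => ?_) Finset.univ_nonempty) _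
  have : (0 : ℝ) < j k := by exact_mod_cast (j k).pos
  positivity

theorem modeWeight_pos (hn : 1 ≤ n) (hT : 0 < T) (j : Fin n → ℕ+) : 0 < modeWeight α T j := by
  have h := modeEigenvalue_pos (α := α) hn j
  exact lt_of_lt_of_le (by positivity) (add_le_timeWeight h hT)

theorem modeWeight_mono (hn : 1 ≤ n) (hT : 0 < T) {i j : Fin n → ℕ+}
    (h : modeEigenvalue α i ≤ modeEigenvalue α j) : modeWeight α T i ≤ modeWeight α T j :=
  timeWeight_le_timeWeight (modeEigenvalue_pos hn i) h hT

theorem eq_one_of_modeEigenvalue_le (hα : 0 < α) {j : Fin n → ℕ+}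
    (h : modeEigenvalue α j ≤ modeEigenvalue α (fun _ : Fin n => (1 : ℕ+))) : j = fun _ => 1 := by
  rw [modeEigenvalue, modeEigenvalue, Real.rpow_le_rpow_iff (by positivity) (by positivity) hα] at h
  have h1 : ∀ k, (1 : ℝ) ≤ j k := fun k => by exact_mod_cast (one_le : 1 ≤ j k)
  have h2 : ∀ k ∈ Finset.univ, (((1 : ℕ+) : ℕ) : ℝ) ^ 2 ≤ (j k : ℝ) ^ 2 := fun k _ => by
    rw [PNat.one_coe, Nat.cast_one, one_pow]
    exact one_le_pow₀ (h1 k)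
  have h3 := (Finset.sum_eq_sum_iff_of_le h2).1 (le_antisymm (Finset.sum_le_sum h2) h)
  ext k
  have h4 := h3 k (Finset.mem_univ k)
  have h5 : (j k : ℝ) = 1 := by
    have : (j k : ℝ) ^ 2 = 1 ^ 2 := by simpa using h4.symm
    exact (sq_eq_sq₀ (by positivity) zero_le_one).1 this
  simpa using h5

theorem finite_modeEigenvalue_le (hα : 0 < α) (c : ℝ) :
    {j : Fin n → ℕ+ | modeEigenvalue α j ≤ c}.Finite := by
  obtain ⟨B, hB⟩ := eventually_atTop.1 ((tendsto_rpow_atTop hα).eventually_gt_atTop c)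
  refine (Set.finite_Icc (fun _ : Fin n => (1 : ℕ+)) (fun _ => ⟨⌈B⌉₊ + 1, by positivity⟩)).subset ?_
  intro j hj
  refine ⟨fun k => one_le, fun k => ?_⟩
  have hlt : ∑ k, (j k : ℝ) ^ 2 < B := by
    by_contra! h
    exact (hB _ h).not_ge hj
  have h1 : (1 : ℝ) ≤ j k := by exact_mod_cast (one_le : 1 ≤ j k)
  have h2 : (j k : ℝ) ^ 2 ≤ ∑ k, (j k : ℝ) ^ 2 :=
    Finset.single_le_sum (f := fun k => (j k : ℝ) ^ 2) (fun _ _ => sq_nonneg _) (Finset.mem_univ k)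
  have h3 : (j k : ℝ) ≤ (⌈B⌉₊ + 1 : ℕ) := by
    push_cast
    nlinarith [Nat.le_ceil B]
  have h4 : (j k : ℕ) ≤ ⌈B⌉₊ + 1 := by exact_mod_cast h3
  exact h4

theorem tendsto_modeWeight_cofinite (hn : 1 ≤ n) (hα : 0 < α) (hT : 0 < T) :
    Tendsto (modeWeight (n := n) α T) cofinite atTop := by
  refine tendsto_atTop.2 fun c => ?_
  rw [eventually_cofinite]
  refine (finite_modeEigenvalue_le hα (c / T ^ 2)).subset fun j hj => ?_
  have h := add_le_timeWeight (modeEigenvalue_pos (α := α) hn j) hT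
  have h1 : modeWeight α T j < c := not_le.1 hj
  change modeEigenvalue α j ≤ c / T ^ 2
  rw [le_div_iff₀ (by positivity)]
  unfold modeWeight at h1
  linarith

theorem infinite_modes (hn : 1 ≤ n) : Infinite (Fin n → ℕ+) := by
  refine Infinite.of_injective (fun (m : ℕ+) (_ : Fin n) => m) fun a b h => ?_
  exact congrFun h ⟨0, hn⟩

theorem exists_isOrderedEnumeration (hn : 1 ≤ n) (hα : 0 < α) :
    ∃ σ : ℕ+ ≃ (Fin n → ℕ+), IsOrderedEnumeration α σ := by
  classical
  have := infinite_modes hn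
  obtain ⟨e, he⟩ := exists_injective_nat (Fin n → ℕ+)
  -- Ties between eigenvalues are broken by an injection into `ℕ`. Each mode then has finitely many
  -- predecessors; their number is an injective rank, and its infinite range is order isomorphic to
  -- `ℕ`.
  let key : (Fin n → ℕ+) → ℝ ×ₗ ℕ := fun j => toLex (modeEigenvalue α j, e j)
  have hkey : Function.Injective key := fun i j h => he (congrArg Prod.snd (toLex.injective h))
  have hle : ∀ {i j}, key i ≤ key j → modeEigenvalue α i ≤ modeEigenvalue α j := by
    intro i j h
    rcases (Prod.Lex.le_iff).1 h with h | h
    · exact h.le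
    · exact h.1.le
  have hfin : ∀ j, {i | key i < key j}.Finite := fun j =>
    (finite_modeEigenvalue_le hα (modeEigenvalue α j)).subset fun i hi => hle (le_of_lt hi)
  let rank : (Fin n → ℕ+) → ℕ := fun j => {i | key i < key j}.ncard
  have hrank : ∀ {i j}, key i < key j → rank i < rank j := by
    intro i j h
    refine Set.ncard_lt_ncard ⟨fun l hl => lt_trans hl h, fun hsub => ?_⟩ (hfin j)
    exact lt_irrefl (key i) (hsub h)
  have hinj : Function.Injective rank := by
    intro i j h
    by_contra hne
    rcases lt_or_gt_of_ne (fun h' => hne (hkey h')) with h' | h'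
    · exact (hrank h').ne h
    · exact (hrank h').ne' h
  have hinf : Infinite (Set.range rank) := Set.infinite_range_of_injective hinj |>.to_subtype
  let o : ℕ ≃o Set.range rank := Nat.Subtype.orderIsoOfNat (Set.range rank)
  let E := Equiv.ofInjective rank hinj
  refine ⟨Equiv.pnatEquivNat.trans (o.toEquiv.trans E.symm), fun a b hab => hle ?_⟩
  by_contra! hlt
  have h1 := hrank hlt
  have h2 : ∀ c, rank (E.symm (o c)) = o c := fun c =>
    congrArg Subtype.val (E.apply_symm_apply (o c))
  have h3 : o (Equiv.pnatEquivNat a) ≤ o (Equiv.pnatEquivNat b) := by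
    refine o.monotone ?_
    simpa [Equiv.pnatEquivNat] using PNat.natPred_le_natPred.2 hab
  simp only [Equiv.trans_apply] at h1
  have h4 := h2 (Equiv.pnatEquivNat a)
  have h5 := h2 (Equiv.pnatEquivNat b)
  have h6 : (o (Equiv.pnatEquivNat a) : ℕ) ≤ o (Equiv.pnatEquivNat b) := h3
  have h7 : rank (E.symm (o (Equiv.pnatEquivNat b))) < rank (E.symm (o (Equiv.pnatEquivNat a))) := h1
  omega

theorem volume_real_orthotope (n : ℕ) : volume.real (orthotope n) = Real.pi ^ n := by
  rw [← boxMeasure_real_univ, ← volume_restrict_orthotope, measureReal_restrict_apply_univ]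

theorem spectralH2 (hn : 1 ≤ n) (hα : 0 < α) (hT : 0 < T) {L : ℝ} (hL : 0 < L) :
    SpectralH2 n α T L := by
  intro a ha hint
  have hpos : 0 < sineLowerBound n (∫ x in orthotope n, a x) := by
    refine sineLowerBound_pos n ?_
    rw [hint, volume_real_orthotope]
    exact mul_pos hL (pow_pos Real.pi_pos n)
  set c := modeWeight α T (fun _ : Fin n => (1 : ℕ+)) with hc
  -- The terms tend to infinity; the margin `1` keeps the inequality strict after passing to the
  -- inferior limit.
  have hev : ∀ᶠ j in cofinite, (((c + 1 : ℝ)) : EReal) ≤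
      ((modeWeight α T j * ∫ x in orthotope n, a x * sineMode j x ^ 2 : ℝ) : EReal) := by
    filter_upwards [(tendsto_modeWeight_cofinite hn hα hT).eventually_ge_atTop
      ((c + 1) / sineLowerBound n (∫ x in orthotope n, a x))] with j hj
    rw [EReal.coe_le_coe_iff]
    rw [div_le_iff₀ hpos] at hj
    exact hj.trans (mul_le_mul_of_nonneg_left (sineLowerBound_le_integral j ha)
      (modeWeight_pos hn hT j).le)
  refine lt_of_lt_of_le ?_ (le_liminf_of_le (by isBoundedDefault) hev)
  exact EReal.coe_lt_coe_iff.2 (lt_add_one c)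

end Weights

/-! ### Reduction to finitely many modes, and analyticity -/

section Admissible

variable {n : ℕ} {α T L : ℝ}

theorem isOpen_orthotope (n : ℕ) : IsOpen (orthotope n) :=
  isOpen_set_pi Set.finite_univ fun _ _ => isOpen_Ioo

theorem boxMeasure_restrict_of_subset {ω : Set (Fin n → ℝ)} (h : ω ⊆ orthotope n) :
    (boxMeasure n).restrict ω = volume.restrict ω := by
  rw [← volume_restrict_orthotope, Measure.restrict_restrict_of_subset h]

theorem boxMeasure_real_of_subset {ω : Set (Fin n → ℝ)} (h : ω ⊆ orthotope n) :
    (boxMeasure n).real ω = volume.real ω := by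
  rw [← measureReal_restrict_apply_univ, boxMeasure_restrict_of_subset h,
    measureReal_restrict_apply_univ]

theorem boxMeasure_absolutelyContinuous (n : ℕ) : boxMeasure n ≪ volume := by
  rw [← volume_restrict_orthotope]
  exact Measure.absolutelyContinuous_of_le Measure.restrict_le_self

theorem volume_orthotope_ne_top (n : ℕ) : volume (orthotope n) ≠ ⊤ := by
  rw [← Measure.restrict_apply_univ, volume_restrict_orthotope]
  exact measure_ne_top _ _

theorem volume_real_of_mem_admissibleSets (hL : 0 ≤ L) {ω : Set (Fin n → ℝ)}
    (h : ω ∈ admissibleSets n L) : volume.real ω = L * Real.pi ^ n := by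
  rw [Measure.real, h.2.2, ENNReal.toReal_mul, ENNReal.toReal_ofReal hL]
  rw [← volume_real_orthotope, Measure.real]

theorem integrable_sineMode_sq (j : Fin n → ℕ+) :
    Integrable (fun x => sineMode j x ^ 2) (boxMeasure n) :=
  integrable_boxMeasure_of_bound ((continuous_sineMode j).measurable.pow_const 2) fun x => by
    rw [abs_of_nonneg (sq_nonneg _)]
    exact sineMode_sq_le j x

theorem sineLowerBound_le_setIntegral (hL : 0 ≤ L) {ω : Set (Fin n → ℝ)}
    (h : ω ∈ admissibleSets n L) (j : Fin n → ℕ+) :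
    sineLowerBound n (L * Real.pi ^ n) ≤ ∫ x in ω, sineMode j x ^ 2 := by
  have hω : NullMeasurableSet ω (boxMeasure n) := h.2.1.mono_ac (boxMeasure_absolutelyContinuous n)
  have hd : IsDensity n (ω.indicator fun _ => 1) := by
    rw [IsDensity, volume_restrict_orthotope]
    refine ⟨(aestronglyMeasurable_const (b := (1 : ℝ))).indicator₀ hω, ae_of_all _ fun x => ?_⟩
    by_cases hx : x ∈ ω <;> simp [hx]
  have h1 := sineLowerBound_le_integral j hd
  have h2 : (fun x => ω.indicator (fun _ => (1 : ℝ)) x * sineMode j x ^ 2) =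
      ω.indicator fun x => sineMode j x ^ 2 := by
    ext x
    by_cases hx : x ∈ ω <;> simp [hx]
  rw [h2, volume_restrict_orthotope, integral_indicator₀ hω, integral_indicator₀ hω,
    boxMeasure_restrict_of_subset h.1] at h1
  simpa [volume_real_of_mem_admissibleSets hL h] using h1

theorem setIntegral_sineMode_one_sq_le {ω : Set (Fin n → ℝ)} (h : ω ⊆ orthotope n) :
    ∫ x in ω, sineMode (fun _ => 1) x ^ 2 ≤ 1 := by
  rw [← integral_sineMode_one_sq n, volume_restrict_orthotope, ← boxMeasure_restrict_of_subset h]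
  exact setIntegral_le_integral (integrable_sineMode_sq _) (ae_of_all _ fun x => sq_nonneg _)

/-- On admissible sets, the modes of large weight do not contribute to the infimum. -/
theorem iInf_modes_eq_obsFunctional (hn : 1 ≤ n) (hT : 0 < T) (hL : 0 < L)
    {ι : Type*} (e : ι → Fin n → ℕ+) (hone : ∃ i, e i = fun _ => 1)
    (hlarge : ∀ j, (∃ i, e i = j) ∨ modeWeight α T (fun _ : Fin n => (1 : ℕ+)) /
      sineLowerBound n (L * Real.pi ^ n) ≤ modeWeight α T j)
    {ω : Set (Fin n → ℝ)} (hω : ω ∈ admissibleSets n L) :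
    (⨅ i, modeWeight α T (e i) * ∫ x in ω, sineMode (e i) x ^ 2) = obsFunctional α T ω := by
  have hpos : 0 < sineLowerBound n (L * Real.pi ^ n) :=
    sineLowerBound_pos n (mul_pos hL (pow_pos Real.pi_pos n))
  have h0 : ∀ j, 0 ≤ modeWeight α T j * ∫ x in ω, sineMode j x ^ 2 := fun j =>
    mul_nonneg (modeWeight_pos hn hT j).le (integral_nonneg fun x => sq_nonneg _)
  have hb1 : BddBelow (Set.range fun i => modeWeight α T (e i) * ∫ x in ω, sineMode (e i) x ^ 2) :=
    ⟨0, by rintro _ ⟨i, rfl⟩; exact h0 _⟩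
  have hb2 : BddBelow (Set.range fun j => modeWeight α T j * ∫ x in ω, sineMode j x ^ 2) :=
    ⟨0, by rintro _ ⟨i, rfl⟩; exact h0 _⟩
  obtain ⟨i₀, hi₀⟩ := hone
  have : Nonempty ι := ⟨i₀⟩
  refine le_antisymm (le_ciInf fun j => ?_) (le_ciInf fun i => ciInf_le hb2 (e i))
  rcases hlarge j with ⟨i, rfl⟩ | hj
  · exact ciInf_le hb1 i
  -- A mode of large weight is dominated by the first one: `γ_𝟏 ∫_ω φ_𝟏² ≤ γ_𝟏 ≤ γ_j f^{[n]}(L) ≤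
  -- γ_j ∫_ω φ_j²`.
  · refine (ciInf_le hb1 i₀).trans ?_
    rw [hi₀]
    rw [div_le_iff₀ hpos] at hj
    calc _ ≤ modeWeight α T (fun _ : Fin n => (1 : ℕ+)) * 1 :=
          mul_le_mul_of_nonneg_left (setIntegral_sineMode_one_sq_le hω.1) (modeWeight_pos hn hT _).le
      _ ≤ modeWeight α T j * sineLowerBound n (L * Real.pi ^ n) := by rwa [mul_one]
      _ ≤ _ := mul_le_mul_of_nonneg_left (sineLowerBound_le_setIntegral hL.le hω j)
          (modeWeight_pos hn hT j).le

theorem analyticAt_sineMode (j : Fin n → ℕ+) (x : Fin n → ℝ) : AnalyticAt ℝ (sineMode j) x := by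
  unfold sineMode
  refine analyticAt_const.mul (Finset.analyticAt_fun_prod _ fun k _ => ?_)
  have h : AnalyticAt ℝ (fun y : Fin n → ℝ => (j k : ℝ) * y k) x := analyticAt_const.mul
    ((ContinuousLinearMap.proj (R := ℝ) (φ := fun _ : Fin n => ℝ) k).analyticAt x)
  exact Real.analyticAt_sin.comp h

theorem exists_sineMode_ne_zero (j : Fin n → ℕ+) : ∃ x, sineMode j x ≠ 0 := by
  have hpi := Real.pi_pos
  refine ⟨fun k => Real.pi / 2 / j k, ?_⟩
  have : ∀ k, Real.sin (j k * (Real.pi / 2 / j k)) = 1 := fun k => by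
    have : (j k : ℝ) ≠ 0 := by exact_mod_cast (j k).ne_zero
    rw [mul_div_cancel₀ _ this, Real.sin_pi_div_two]
  simp only [sineMode, this, Finset.prod_const_one, mul_one]
  positivity

theorem sineMode_zero (hn : 1 ≤ n) (j : Fin n → ℕ+) : sineMode j 0 = 0 := by
  have : ∏ k, Real.sin ((j k : ℝ) * (0 : Fin n → ℝ) k) = 0 :=
    Finset.prod_eq_zero (Finset.mem_univ ⟨0, hn⟩) (by simp)
  rw [sineMode, this, mul_zero]

/-- Level sets of convex combinations of weighted squared modes are null. -/
theorem volume_levelSet_modes_eq_zero (hn : 1 ≤ n) {ι : Type*} [Fintype ι] (e : ι → Fin n → ℕ+)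
    {w : ι → ℝ} (hw : ∀ i, 0 < w i) {b : ι → ℝ} (hb : b ∈ stdSimplex ℝ ι) (ξ : ℝ) :
    volume {x | ∑ i, b i * (w i * sineMode (e i) x ^ 2) = ξ} = 0 := by
  have han : AnalyticOnNhd ℝ (fun x => ∑ i, b i * (w i * sineMode (e i) x ^ 2) - ξ) Set.univ := by
    intro x _
    refine (Finset.analyticAt_fun_sum _ fun i _ => ?_).sub analyticAt_const
    exact analyticAt_const.mul (analyticAt_const.mul ((analyticAt_sineMode (e i) x).pow 2))
  obtain ⟨x, hx⟩ : ∃ x, ∑ i, b i * (w i * sineMode (e i) x ^ 2) - ξ ≠ 0 := by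
    -- If the combination were constantly `ξ`, its value at the origin would give `ξ = 0`. All its
    -- nonnegative terms would then vanish identically, although some coefficient is positive.
    by_contra! h
    have hξ : ξ = 0 := by simpa [sineMode_zero hn] using h 0
    obtain ⟨i, -, hi⟩ : ∃ i ∈ Finset.univ, 0 < b i := by
      refine Finset.exists_lt_of_sum_lt (f := fun _ => (0 : ℝ)) ?_
      rw [hb.2]
      simp
    obtain ⟨x, hx⟩ := exists_sineMode_ne_zero (e i)
    have h1 := h x
    rw [hξ, sub_zero, Finset.sum_eq_zero_iff_of_nonneg fun k _ =>
      mul_nonneg (hb.1 k) (mul_nonneg (hw k).le (sq_nonneg _))] at h1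
    have h2 := h1 i (Finset.mem_univ i)
    have h3 : 0 < b i * (w i * sineMode (e i) x ^ 2) :=
      mul_pos hi (mul_pos (hw i) (by positivity))
    exact h3.ne' h2
  simpa [sub_eq_zero] using volume_zeroSet_eq_zero_of_analyticOnNhd han hx

theorem isSemiAnalytic_orthotope_inter_superlevel {ψ : (Fin n → ℝ) → ℝ}
    (hψ : AnalyticOnNhd ℝ ψ Set.univ) (ξ : ℝ) :
    IsSemiAnalytic (orthotope n ∩ {x | ξ < ψ x}) := by
  intro x
  have hc : ∀ k, AnalyticOnNhd ℝ (fun y : Fin n → ℝ => y k) Set.univ := fun k y _ =>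
    (ContinuousLinearMap.proj (R := ℝ) (φ := fun _ : Fin n => ℝ) k).analyticAt y
  -- One global piece suffices, with no equation and `2n + 1` inequalities: `0 < y k`, `0 < π - y k`
  -- and `0 < ψ y - ξ`.
  refine ⟨Set.univ, isOpen_univ, Set.mem_univ x, 1, 0, n + n + 1, fun _ k => k.elim0,
    fun _ => Fin.snoc (α := fun _ => (Fin n → ℝ) → ℝ)
      (Fin.append (fun k y => y k) fun k y => Real.pi - y k) fun y => ψ y - ξ,
    fun _ k => k.elim0, fun _ k => ?_, ?_⟩
  · refine Fin.lastCases ?_ (fun k => ?_) k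
    · simp only [Fin.snoc_last]
      exact hψ.sub analyticOnNhd_const
    · refine Fin.addCases (fun k => ?_) (fun k => ?_) k
      · simpa using hc k
      · simp only [Fin.snoc_castSucc, Fin.append_right]
        exact analyticOnNhd_const.sub (hc k)
  · ext y
    simp only [Fin.forall_fin_succ', Fin.forall_fin_add, Fin.snoc_castSucc, Fin.snoc_last,
      Fin.append_left, Fin.append_right]
    simp [orthotope, forall_and]

end Admissible

/-! ### The optimal set -/

/-- For finitely many modes, the maximin problem over admissible sets has a unique solution, and
it is open and semi-analytic. -/
theorem exists_isUniqueOptimalSet_finite_modes {n : ℕ} (hn : 1 ≤ n) {α T L : ℝ} (hT : 0 < T)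
    (hL : L ∈ Set.Ioo (0 : ℝ) 1) {ι : Type*} [Finite ι] [Nonempty ι] (e : ι → Fin n → ℕ+) :
    ∃ ω : Set (Fin n → ℝ), IsOpen ω ∧ IsSemiAnalytic ω ∧
      IsUniqueOptimalSet n L
        (fun ω => ⨅ i, modeWeight α T (e i) * ∫ x in ω, sineMode (e i) x ^ 2) ω := by
  have := Fintype.ofFinite ι
  have hpi := Real.pi_pos
  have hw : ∀ i, 0 < modeWeight α T (e i) := fun i => modeWeight_pos hn hT (e i)
  have hC : ∀ i x, |modeWeight α T (e i) * sineMode (e i) x ^ 2| ≤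
      ∑ i, modeWeight α T (e i) * (2 / Real.pi) ^ n := by
    intro i x
    rw [abs_of_nonneg (mul_nonneg (hw i).le (sq_nonneg _))]
    refine (mul_le_mul_of_nonneg_left (sineMode_sq_le (e i) x) (hw i).le).trans ?_
    exact Finset.single_le_sum (f := fun i => modeWeight α T (e i) * (2 / Real.pi) ^ n)
      (fun i _ => mul_nonneg (hw i).le (by positivity)) (Finset.mem_univ i)
  have hC0 : 0 ≤ ∑ i, modeWeight α T (e i) * (2 / Real.pi) ^ n :=
    Finset.sum_nonneg fun i _ => mul_nonneg (hw i).le (by positivity)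
  have hm : L * Real.pi ^ n ∈ Set.Icc 0 ((boxMeasure n).real Set.univ) := by
    rw [boxMeasure_real_univ]
    exact ⟨mul_nonneg hL.1.le (by positivity), mul_le_of_le_one_left (by positivity) hL.2.le⟩
  obtain ⟨b, hb, ξ, hξ, hopt⟩ := exists_superlevel_unique_maximin (μ := boxMeasure n)
    (g := fun i x => modeWeight α T (e i) * sineMode (e i) x ^ 2)
    (fun i => ((continuous_sineMode (e i)).measurable.pow_const 2).const_mul _) hC0 hC
    (fun b hb ξ => boxMeasure_absolutelyContinuous n (volume_levelSet_modes_eq_zero hn e hw hb ξ)) hm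
  set ψ : (Fin n → ℝ) → ℝ := fun x => ∑ i, b i * (modeWeight α T (e i) * sineMode (e i) x ^ 2)
    with hψ
  have hψa : AnalyticOnNhd ℝ ψ Set.univ := by
    intro x _
    refine Finset.analyticAt_fun_sum _ fun i _ => ?_
    exact analyticAt_const.mul (analyticAt_const.mul ((analyticAt_sineMode (e i) x).pow 2))
  have hψc : Continuous ψ := continuousOn_univ.1 hψa.continuousOn
  have hopen : IsOpen {x | ξ < ψ x} := isOpen_lt continuous_const hψc
  have hΩm := (isOpen_orthotope n).measurableSet
  have hres : (boxMeasure n).restrict {x | ξ < ψ x} =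
      volume.restrict (orthotope n ∩ {x | ξ < ψ x}) := by
    rw [← volume_restrict_orthotope, Measure.restrict_restrict hopen.measurableSet, Set.inter_comm]
  have hωo : IsOpen (orthotope n ∩ {x | ξ < ψ x}) := (isOpen_orthotope n).inter hopen
  have hωm : volume.real (orthotope n ∩ {x | ξ < ψ x}) = L * Real.pi ^ n := by
    rw [← hξ, ← measureReal_restrict_apply_univ, ← hres, measureReal_restrict_apply_univ]
  have hval : ∀ {ω : Set (Fin n → ℝ)}, ω ∈ admissibleSets n L → NullMeasurableSet ω (boxMeasure n) ∧
      (boxMeasure n).real ω = L * Real.pi ^ n := fun {ω} hω =>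
    ⟨hω.2.1.mono_ac (boxMeasure_absolutelyContinuous n), by
      rw [boxMeasure_real_of_subset hω.1, volume_real_of_mem_admissibleSets hL.1.le hω]⟩
  have hres' : (boxMeasure n).restrict
      {x | ξ < ∑ i, b i * (modeWeight α T (e i) * sineMode (e i) x ^ 2)} =
      volume.restrict (orthotope n ∩ {x | ξ < ψ x}) := hres
  simp only [hres', integral_const_mul] at hopt
  refine ⟨_, hωo, isSemiAnalytic_orthotope_inter_superlevel hψa ξ, ⟨?_, ?_, ?_⟩, ?_, ?_⟩
  · exact Set.inter_subset_left
  · exact hωo.measurableSet.nullMeasurableSet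
  · have hfin : volume (orthotope n ∩ {x | ξ < ψ x}) ≠ ⊤ :=
      ne_top_of_le_ne_top (volume_orthotope_ne_top n) (measure_mono Set.inter_subset_left)
    rw [← ENNReal.toReal_eq_toReal_iff' hfin
      (ENNReal.mul_ne_top ENNReal.ofReal_ne_top (volume_orthotope_ne_top n)), ENNReal.toReal_mul,
      ENNReal.toReal_ofReal hL.1.le]
    change volume.real _ = L * volume.real _
    rw [hωm, volume_real_orthotope]
  · intro ω hω
    have h := (hopt ω (hval hω).1 (hval hω).2).1
    rwa [boxMeasure_restrict_of_subset hω.1] at h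
  · intro ω hω heq
    have h := (hopt ω (hval hω).1 (hval hω).2).2
    rw [boxMeasure_restrict_of_subset hω.1] at h
    have h1 := h heq
    rw [← volume_restrict_orthotope, eventuallyEq_set, ae_restrict_iff' hΩm] at h1
    rw [eventuallyEq_set]
    filter_upwards [h1] with x hx
    by_cases hxΩ : x ∈ orthotope n
    · rw [hx hxΩ]
      exact ⟨fun h => ⟨hxΩ, h⟩, fun h => h.2⟩
    · exact ⟨fun h => absurd (hω.1 h) hxΩ, fun h => absurd h.1 hxΩ⟩

theorem IsUniqueOptimalSet.congr {n : ℕ} {L : ℝ} {Φ Ψ : Set (Fin n → ℝ) → ℝ}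
    {ω : Set (Fin n → ℝ)} (h : IsUniqueOptimalSet n L Φ ω)
    (heq : ∀ ω' ∈ admissibleSets n L, Φ ω' = Ψ ω') : IsUniqueOptimalSet n L Ψ ω := by
  obtain ⟨h1, h2, h3⟩ := h
  refine ⟨h1, fun ω' hω' => ?_, fun ω' hω' he => h3 ω' hω' ?_⟩
  · rw [← heq ω' hω', ← heq ω h1]
    exact h2 ω' hω'
  · rw [heq ω' hω', heq ω h1, he]

theorem theorem3 (n : ℕ) (hn : 1 ≤ n) (α T L : ℝ) (hα : 0 < α) (hT : 0 < T)
    (hL : L ∈ Set.Ioo (0 : ℝ) 1) :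
    -- the uniform lower bound
    (∀ ρ : (Fin n → ℝ) → ℝ, IsDensity n ρ →
      (∀ j : Fin n → ℕ+, sineLowerBound n (∫ x in orthotope n, ρ x) ≤
        ∫ x in orthotope n, ρ x * sineMode j x ^ 2) ∧
      (0 < ∫ x in orthotope n, ρ x → 0 < sineLowerBound n (∫ x in orthotope n, ρ x))) ∧
    -- the spectral assumption
    SpectralH2 n α T L ∧
    -- the modes can be listed by nondecreasing eigenvalue
    (∃ σ : ℕ+ ≃ (Fin n → ℕ+), IsOrderedEnumeration α σ) ∧
    -- the unique optimal set, and its determination by finitely many modes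
    ∃ ω : Set (Fin n → ℝ), IsOpen ω ∧ IsSemiAnalytic ω ∧
      IsUniqueOptimalSet n L (obsFunctional α T) ω ∧
      ∀ σ : ℕ+ ≃ (Fin n → ℕ+), IsOrderedEnumeration α σ →
        ∃ N₀ : ℕ+,
          IsLeast {N : ℕ+ | modeWeight α T (fun _ : Fin n => (1 : ℕ+)) /
            sineLowerBound n (L * Real.pi ^ n) ≤ modeWeight α T (σ N)} N₀ ∧
          ∀ N : ℕ+, N₀ ≤ N →
            IsUniqueOptimalSet n L (truncFunctional α T σ N) ω ∧
            truncFunctional α T σ N ω = obsFunctional α T ω := by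
  have htend := tendsto_modeWeight_cofinite (n := n) hn hα hT
  refine ⟨fun ρ hρ => ⟨fun j => sineLowerBound_le_integral j hρ, sineLowerBound_pos n⟩,
    spectralH2 hn hα hT hL.1, exists_isOrderedEnumeration hn hα, ?_⟩
  set c := modeWeight α T (fun _ : Fin n => (1 : ℕ+)) / sineLowerBound n (L * Real.pi ^ n) with hc
  -- The first mode is inserted by hand because it is the one that dominates the discarded modes.
  let S : Set (Fin n → ℕ+) := insert (fun _ => 1) {j | ¬ c ≤ modeWeight α T j}
  have hS : S.Finite := Set.Finite.insert _ (eventually_cofinite.1 (htend.eventually_ge_atTop c))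
  have : Finite S := hS
  have : Nonempty S := ⟨⟨_, Set.mem_insert _ _⟩⟩
  obtain ⟨ω, hopen, hsemi, hω⟩ := exists_isUniqueOptimalSet_finite_modes (α := α) hn hT hL
    (fun j : S => j.1)
  have hJ : IsUniqueOptimalSet n L (obsFunctional α T) ω := by
    refine hω.congr fun ω' hω' => ?_
    refine iInf_modes_eq_obsFunctional hn hT hL.1 _ ⟨⟨_, Set.mem_insert _ _⟩, rfl⟩ (fun j => ?_) hω'
    by_cases hj : c ≤ modeWeight α T j
    · exact Or.inr hj
    · exact Or.inl ⟨⟨j, Set.mem_insert_of_mem _ hj⟩, rfl⟩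
  refine ⟨ω, hopen, hsemi, hJ, fun σ hσ => ?_⟩
  have hne : {N : ℕ+ | c ≤ modeWeight α T (σ N)}.Nonempty := by
    have := infinite_modes hn
    obtain ⟨j, hj⟩ := (htend.eventually_ge_atTop c).exists
    exact ⟨σ.symm j, by simpa using hj⟩
  obtain ⟨N₀, hN₀, hmin⟩ := WellFounded.has_min (wellFounded_lt (α := ℕ+)) _ hne
  refine ⟨N₀, ⟨hN₀, fun N hN => not_lt.1 (hmin N hN)⟩, fun N hN => ?_⟩
  -- The lowest eigenvalue is simple, so every ordered enumeration starts with the first mode and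
  -- every truncation contains it.
  have hfirst : σ 1 = fun _ => 1 := by
    refine eq_one_of_modeEigenvalue_le hα ?_
    simpa using hσ (one_le : 1 ≤ σ.symm fun _ => 1)
  have heq : ∀ ω' ∈ admissibleSets n L, truncFunctional α T σ N ω' = obsFunctional α T ω' := by
    intro ω' hω'
    refine iInf_modes_eq_obsFunctional hn hT hL.1 (fun i : Set.Iic N => σ i)
      ⟨⟨1, Set.mem_Iic.2 one_le⟩, hfirst⟩ (fun j => ?_) hω'
    rcases le_total (σ.symm j) N with h | h
    · exact Or.inl ⟨⟨σ.symm j, h⟩, by simp⟩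
    · refine Or.inr (le_trans hN₀ (modeWeight_mono hn hT ?_))
      simpa using hσ (hN.trans h)
  exact ⟨hJ.congr fun ω' hω' => (heq ω' hω').symm, heq ω hJ.1⟩
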